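/- Let $n\ge 2$ and $\ell\ge 1$ be integers. Let $\operatorname{ASL}_n(\mathbb R)=\operatorname{SL}_n(\mathbb R)\ltimes\mathbb R^n$ act on $\mathbb R^n$ by $\langle h,\mathbf z\rangle\mathbf x=\mathbf z+h\mathbf x$, let $G$ be a closed subgroup of $\operatorname{ASL}_n(\mathbb R)$, and let $\mathcal P\subseteq\mathbb Z^n$. Suppose that $\Gamma=\{g\in G: g\mathcal P=\mathcal P\}$ is a lattice in $G$; set $X=G/\Gamma$ and let $\mu_X$ be the $G$-invariant Radon probability measure on $X$. For $F:\mathbb R^n\to\mathbb R_{\ge0}$ write $\widehat F(g\Gamma)=\sum_{\mathbf v\in\mathcal P}F(g\mathbf v)\in[0,\infty]$, and let $m$ denote Lebesgue measure. Suppose that: (a) ($G$ is of $\mathcal P$-Siegel type) there is a constant $c>0$ such that $\int_X\widehat F\,d\mu_X=c\int_{\mathbb R^n}F\,dm$ for every bounded, compactly supported Borel function $F:\mathbb R^n\to\mathbb R_{\ge0}$; (b) ($G$ is of $(\mathcal P,r)$-Rogers type) $r>1$ is a real number for which there is a constant $D>0$ such that $\bigl\|\widehat{\mathbf 1_E}-\int_X\widehat{\mathbf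 1_E}\,d\mu_X\bigr\|_{L^r(\mu_X)}\le D\,m(E)^{1/r}$ for every bounded Borel set $E\subset\mathbb R^n$ with $m(E)>0$. Let $\nu$ be an arbitrary norm on $\mathbb R^n$. Let $\psi=(\psi_1,\dots,\psi_\ell):\mathbb R_{\ge0}\to(\mathbb R_{>0})^\ell$ be Borel measurable with each $\psi_j$ nonincreasing, and suppose that $\psi$ is regular: there are $a>1$ and $b>0$ with $b\,\psi_j(z)\le\psi_j(az)$ for all $z>0$ and all $j$. Let $f=(f_1,\dots,f_\ell):\mathbb R^n\to\mathbb R^\ell$ be Borel measurable and homogeneous of degree $(d_1,\dots,d_\ell)\in(\mathbb R_{>0})^\ell$, i.e. $f_j(t\mathbf x)=t^{d_j}f_j(\mathbf x)$ for all $t\ge0$, all $j$ and all $\mathbf x\in\mathbb R^n$. Suppose that $f$ is continuously differentiable on $\mathbb R^n\smallsetminus\{\mathbf 0\}$, that $\mathcal Z(f)=f^{-1}(\mathbf 0)\smallsetminus\{\mathbf 0\}$ is nonempty, and that the derivative $D_{\mathbf x}f:\mathbb R^n\to\mathbb R^\ell$ is surjective for every $\mathbf x\in\mathcal Z(f)$.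 Let $\boldsymbol\xi\in\mathbb R^\ell$, let ${}_{\boldsymbol\xi}f(\mathbf x)=-\boldsymbol\xi+f(\mathbf x)$, and set $d=\sum_{j=1}^\ell d_j$. A function $F=(F_1,\dots,F_\ell):\mathbb R^n\to\mathbb R^\ell$ is called $(\psi,\nu,\mathcal P)$-approximable if there are infinitely many $\mathbf v\in\mathcal P$ with $|F_j(\mathbf v)|\le\psi_j(\nu(\mathbf v))$ for all $j$; it is called uniformly $(\psi,\nu,\mathcal P)$-approximable if for every sufficiently large real $T$ there is $\mathbf v\in\mathcal P$ with $\nu(\mathbf v)\le T$ and $|F_j(\mathbf v)|\le\psi_j(T)$ for all $j$. Then the following hold. (i) If $\int_1^\infty t^{n-(d+1)}\prod_{j=1}^\ell\psi_j(t)\,dt$ is finite (respectively, infinite), then $({}_{\boldsymbol\xi}f)\circ g$ is $(\psi,\nu,\mathcal P)$-approximable for Haar-almost no (respectively, Haar-almost every) $g\in G$. (ii) If $d<n$ and the series $\sum_{k=1}^\infty\bigl[2^{k(n-d)}\prod_{j=1}^\ell\psi_j(2^k)\bigr]^{1-r}$ converges, then $({}_{\boldsymbol\xi}f)\circ g$ is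 uniformly $(\psi,\nu,\mathcal P)$-approximable for Haar-almost every $g\in G$. -/

import Mathlib

open MeasureTheory Filter Set
open scoped ENNReal NNReal Pointwise Matrix

/-- The group `ASL_n(ℝ) = SL_n(ℝ) ⋉ ℝⁿ`: the element `⟨h, z⟩` is the affine map `x ↦ z + h x`. -/
@[ext]
structure ASL (n : ℕ) where
  lin : Matrix.SpecialLinearGroup (Fin n) ℝ
  trans : Fin n → ℝ

namespace ASL

variable {n : ℕ}

instance : One (ASL n) := ⟨⟨1, 0⟩⟩

instance : Mul (ASL n) :=
  ⟨fun g g' => ⟨g.lin * g'.lin, g.trans + (g.lin : Matrix (Fin n) (Fin n) ℝ) *ᵥ g'.trans⟩⟩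

instance : Inv (ASL n) :=
  ⟨fun g => ⟨g.lin⁻¹, -((g.lin⁻¹ : Matrix.SpecialLinearGroup (Fin n) ℝ) :
    Matrix (Fin n) (Fin n) ℝ) *ᵥ g.trans⟩⟩

theorem one_lin : (1 : ASL n).lin = 1 := rfl
theorem one_trans : (1 : ASL n).trans = 0 := rfl
theorem mul_lin (g g' : ASL n) : (g * g').lin = g.lin * g'.lin := rfl
theorem mul_trans (g g' : ASL n) :
    (g * g').trans = g.trans + (g.lin : Matrix (Fin n) (Fin n) ℝ) *ᵥ g'.trans := rfl
theorem inv_lin (g : ASL n) : (g⁻¹).lin = g.lin⁻¹ := rfl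
theorem inv_trans (g : ASL n) :
    (g⁻¹).trans = -((g.lin⁻¹ : Matrix.SpecialLinearGroup (Fin n) ℝ) :
      Matrix (Fin n) (Fin n) ℝ) *ᵥ g.trans := rfl

instance : Group (ASL n) :=
  Group.ofLeftAxioms
    (fun a b c => by
      ext1
      · simp only [mul_lin, mul_assoc]
      · simp only [mul_trans, mul_lin, Matrix.SpecialLinearGroup.coe_mul, Matrix.mulVec_add,
          Matrix.mulVec_mulVec, add_assoc])
    (fun a => by
      ext1
      · simp only [mul_lin, one_lin, one_mul]
      · simp only [mul_trans, one_lin, one_trans, Matrix.SpecialLinearGroup.coe_one,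
          Matrix.one_mulVec, zero_add])
    (fun a => by
      ext1
      · simp only [mul_lin, inv_lin, one_lin, inv_mul_cancel]
      · simp only [mul_trans, inv_lin, inv_trans, one_trans, Matrix.neg_mulVec, neg_add_cancel])

instance : MulAction (ASL n) (Fin n → ℝ) where
  smul g x := g.trans + (g.lin : Matrix (Fin n) (Fin n) ℝ) *ᵥ x
  one_smul x := by
    change (0 : Fin n → ℝ) + ((1 : Matrix.SpecialLinearGroup (Fin n) ℝ) :
      Matrix (Fin n) (Fin n) ℝ) *ᵥ x = x
    simp
  mul_smul g g' x := by
    change (g.trans + (g.lin : Matrix (Fin n) (Fin n) ℝ) *ᵥ g'.trans) +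
        ((g.lin * g'.lin : Matrix.SpecialLinearGroup (Fin n) ℝ) : Matrix (Fin n) (Fin n) ℝ) *ᵥ x =
      g.trans + (g.lin : Matrix (Fin n) (Fin n) ℝ) *ᵥ
        (g'.trans + (g'.lin : Matrix (Fin n) (Fin n) ℝ) *ᵥ x)
    simp only [Matrix.SpecialLinearGroup.coe_mul, Matrix.mulVec_add, Matrix.mulVec_mulVec,
      add_assoc]

theorem smul_def (g : ASL n) (x : Fin n → ℝ) :
    g • x = g.trans + (g.lin : Matrix (Fin n) (Fin n) ℝ) *ᵥ x := rfl

/-- The topology of the product `SL_n(ℝ) × ℝⁿ`. -/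
instance : TopologicalSpace (ASL n) :=
  TopologicalSpace.induced (fun g => (g.lin, g.trans)) inferInstance

theorem isInducing_prod : Topology.IsInducing (fun g : ASL n => (g.lin, g.trans)) := ⟨rfl⟩

theorem continuous_lin : Continuous (ASL.lin : ASL n → _) :=
  continuous_fst.comp isInducing_prod.continuous

theorem continuous_trans : Continuous (ASL.trans : ASL n → _) :=
  continuous_snd.comp isInducing_prod.continuous

instance : IsTopologicalGroup (ASL n) where
  continuous_mul := by
    rw [isInducing_prod.continuous_iff]
    refine ((continuous_lin.comp continuous_fst).mul
      (continuous_lin.comp continuous_snd)).prodMk ?_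
    exact (continuous_trans.comp continuous_fst).add
      ((continuous_subtype_val.comp (continuous_lin.comp continuous_fst)).matrix_mulVec
        (continuous_trans.comp continuous_snd))
  continuous_inv := by
    rw [isInducing_prod.continuous_iff]
    refine continuous_lin.inv.prodMk ?_
    exact (continuous_subtype_val.comp continuous_lin.inv).neg.matrix_mulVec continuous_trans

instance : MeasurableSpace (ASL n) := borel (ASL n)

instance : BorelSpace (ASL n) := ⟨rfl⟩

end ASL

/-- The integer points `ℤⁿ` of `ℝⁿ`. -/
def integerPoints (n : ℕ) : Set (Fin n → ℝ) := {x | ∀ i, ∃ k : ℤ, x i = k}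

/-- The group `Γ(G, 𝒫) = {g ∈ G : g𝒫 = 𝒫}`. -/
abbrev stabGroup {n : ℕ} (G : Subgroup (ASL n)) (P : Set (Fin n → ℝ)) : Subgroup G :=
  MulAction.stabilizer G P

/-- The space `X = G/Γ` of left cosets. It carries the quotient topology and the quotient
σ-algebra (a set is measurable iff its preimage in `G` is Borel); for `G` closed and `Γ` discrete
the latter is the Borel σ-algebra of `X`. -/
abbrev CosetSpace {n : ℕ} (G : Subgroup (ASL n)) (P : Set (Fin n → ℝ)) : Type :=
  G ⧸ stabGroup G P

/-- `Γ` is a lattice in `H`: it is discrete and `H/Γ` carries an `H`-invariant probability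
measure. -/
def IsLatticeIn {H : Type*} [Group H] [TopologicalSpace H] [MeasurableSpace H]
    (Γ : Subgroup H) : Prop :=
  DiscreteTopology Γ ∧
    ∃ μ : Measure (H ⧸ Γ), IsProbabilityMeasure μ ∧ SMulInvariantMeasure H (H ⧸ Γ) μ

theorem siegelSum_eq_of_rel {n : ℕ} (G : Subgroup (ASL n)) (P : Set (Fin n → ℝ))
    (F : (Fin n → ℝ) → ℝ≥0∞) (a b : G) (h : a⁻¹ * b ∈ stabGroup G P) :
    ∑' v : P, F (a • (v : Fin n → ℝ)) = ∑' v : P, F (b • (v : Fin n → ℝ)) := by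
  have key : ∀ c : G, ∑' v : P, F (c • (v : Fin n → ℝ)) =
      ∑' w : (c • P : Set (Fin n → ℝ)), F w := by
    intro c
    have hinj : Set.InjOn (fun v : Fin n → ℝ => c • v) P := (MulAction.injective c).injOn
    exact (tsum_image F hinj).symm
  have hP : b • P = a • P := by
    have h' : (a⁻¹ * b) • P = P := h
    rw [mul_smul, inv_smul_eq_iff] at h'
    exact h'
  rw [key a, key b, hP]

/-- The `𝒫`-Siegel transform `gΓ ↦ ∑_{v ∈ 𝒫} f(gv)`, a function `X → [0, ∞]`. -/
noncomputable def siegelTransform {n : ℕ} (G : Subgroup (ASL n)) (P : Set (Fin n → ℝ))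
    (f : (Fin n → ℝ) → ℝ≥0) : CosetSpace G P → ℝ≥0∞ :=
  Quotient.lift (fun g : G => ∑' v : P, (f (g • (v : Fin n → ℝ)) : ℝ≥0∞))
    (fun a b h => siegelSum_eq_of_rel G P (fun x => (f x : ℝ≥0∞)) a b
      (QuotientGroup.leftRel_apply.mp h))

/-- `G` is of `𝒫`-Siegel type, where `μX` is the invariant probability measure on `X`. -/
def IsSiegelType {n : ℕ} (G : Subgroup (ASL n)) (P : Set (Fin n → ℝ))
    (μX : Measure (CosetSpace G P)) : Prop :=
  ∃ c : ℝ≥0, 0 < c ∧ ∀ f : (Fin n → ℝ) → ℝ≥0, Measurable f → (∃ C, ∀ x, f x ≤ C) →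
    HasCompactSupport f →
      ∫⁻ x, siegelTransform G P f x ∂μX = c * ∫⁻ v, (f v : ℝ≥0∞)

/-- `G` is of `(𝒫, r)`-Rogers type, where `μX` is the invariant probability measure on `X`.
The transform of the indicator of a bounded set has finite values, because it counts the points of
the uniformly discrete set `g𝒫` in a bounded set. The inequality presupposes that its mean is
finite; this part is automatic if `G` is of `𝒫`-Siegel type. -/
def IsRogersType {n : ℕ} (G : Subgroup (ASL n)) (P : Set (Fin n → ℝ)) (r : ℝ)
    (μX : Measure (CosetSpace G P)) : Prop :=
  ∃ D : ℝ≥0, 0 < D ∧ ∀ E : Set (Fin n → ℝ), MeasurableSet E → Bornology.IsBounded E →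
    0 < volume E →
      ∫⁻ y, siegelTransform G P (E.indicator 1) y ∂μX ≠ ∞ ∧
      eLpNorm (fun x => (siegelTransform G P (E.indicator 1) x).toReal -
        (∫⁻ y, siegelTransform G P (E.indicator 1) y ∂μX).toReal) (ENNReal.ofReal r) μX ≤
        D * volume E ^ (1 / r)

/-- `𝒵(f) = f⁻¹(0) ∖ {0}`. -/
def zeroSet {n ℓ : ℕ} (f : (Fin n → ℝ) → (Fin ℓ → ℝ)) : Set (Fin n → ℝ) := f ⁻¹' {0} \ {0}

/-- `A_{f,ψ,ν} = {x : |f(x)| ≼ ψ(ν(x))}`. -/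
def approxSet {n ℓ : ℕ} (f : (Fin n → ℝ) → (Fin ℓ → ℝ)) (ψ : ℝ≥0 → (Fin ℓ → ℝ))
    (ν : Seminorm ℝ (Fin n → ℝ)) : Set (Fin n → ℝ) :=
  {x | ∀ j, |f x j| ≤ ψ (ν x).toNNReal j}

/-- `B_{f,ε,ν,T} = {x : |f(x)| ≼ ε and ν(x) ≤ T}`. -/
def boxSet {n ℓ : ℕ} (f : (Fin n → ℝ) → (Fin ℓ → ℝ)) (ε : Fin ℓ → ℝ)
    (ν : Seminorm ℝ (Fin n → ℝ)) (T : ℝ) : Set (Fin n → ℝ) :=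
  {x | (∀ j, |f x j| ≤ ε j) ∧ ν x ≤ T}

/-- `f` is `(ψ, ν, 𝒫)`-approximable. -/
def IsApproximable {n ℓ : ℕ} (f : (Fin n → ℝ) → (Fin ℓ → ℝ)) (ψ : ℝ≥0 → (Fin ℓ → ℝ))
    (ν : Seminorm ℝ (Fin n → ℝ)) (P : Set (Fin n → ℝ)) : Prop :=
  (approxSet f ψ ν ∩ P).Infinite

/-- `f` is uniformly `(ψ, ν, 𝒫)`-approximable. -/
def IsUniformlyApproximable {n ℓ : ℕ} (f : (Fin n → ℝ) → (Fin ℓ → ℝ))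
    (ψ : ℝ≥0 → (Fin ℓ → ℝ)) (ν : Seminorm ℝ (Fin n → ℝ)) (P : Set (Fin n → ℝ)) : Prop :=
  ∀ᶠ T : ℝ in atTop, (boxSet f (ψ T.toNNReal) ν T ∩ P).Nonempty

/-- `f` is homogeneous of degree `(d₁, …, d_ℓ) ∈ (ℝ_{>0})^ℓ`. -/
def IsHomogeneousOfDegree {n ℓ : ℕ} (f : (Fin n → ℝ) → (Fin ℓ → ℝ)) (d : Fin ℓ → ℝ) : Prop :=
  Measurable f ∧ (∀ j, 0 < d j) ∧
    ∀ t : ℝ, 0 ≤ t → ∀ (j : Fin ℓ) (x : Fin n → ℝ), f (t • x) j = t ^ d j * f x j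

/-- `ψ` is regular. The order on `ℝ^ℓ` is the componentwise one. -/
def IsRegularFun {ℓ : ℕ} (ψ : ℝ≥0 → (Fin ℓ → ℝ)) : Prop :=
  Measurable ψ ∧ ∃ (a : ℝ≥0) (b : ℝ), 1 < a ∧ 0 < b ∧ ∀ z : ℝ≥0, 0 < z → b • ψ z ≤ ψ (a * z)

/-- The shifted function `x ↦ -ξ + f(x)`. -/
def shifted {n ℓ : ℕ} (ξ : Fin ℓ → ℝ) (f : (Fin n → ℝ) → (Fin ℓ → ℝ)) :
    (Fin n → ℝ) → (Fin ℓ → ℝ) :=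
  fun x => -ξ + f x

/-! Everything reduces to volumes. The Siegel formula says that the mean number of points of `g𝒫` in
a bounded set `E` is `c · m(E)`, and the Rogers bound with Chebyshev's inequality says that this
number is at most half its mean with probability `O(m(E)^(1-r))`.

For the volumes, cut `ℝⁿ` into dyadic shells `t < ν ≤ 2t` and rescale each to `t = 1`. By
homogeneity the slab `|f - ξ| ≤ ε` becomes the preimage under `f` of a box with sides `2 t^(-δ_j)
ε_j` that shrinks to `0` as `t → ∞`, whatever `ξ` is. As `f` is a submersion along its zero set, the
preimage of a small box has volume comparable to that of the box. So a shell meets the slab in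
volume comparable to `t^(n-d) ∏ ε_j` (`IsHomogeneousOfDegree.exists_volume_shell_bounds`), and
Cauchy condensation shows that `{|f - ξ| ≤ M ψ(ν)}` has finite volume exactly when the integral in
(i) converges.

If the volume is finite, the expected number of points is finite, so almost every `g𝒫` has finitely
many there. If it is infinite, Chebyshev on bounded truncations of growing volume gives infinitely
many points almost surely. For (ii), the failure probabilities of the dyadic boxes are bounded by
the terms of the given series, and Borel–Cantelli applies.

These arguments compare `ψ` with `ν(gv)`, whereas approximability involves `ν(v)`. The two norms are
comparable away from a bounded set, with a constant depending on `g`. In (i) regularity of `ψ` turns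
this into a factor `M`; in (ii) it is absorbed in a shift by `m` dyadic scales. The almost sure
statements are proved for all natural `M`, or `m`, at once, so that the null set does not depend on
`g`. Finally `ae_of_ae_quotient` carries them from `G/Γ` to `G`. -/

open scoped Topology

/-! ### Volumes of preimages under a submersion -/

section Submersion

/-- Near a point where it is a submersion, a map is a linear map composed with a map that is
strictly tangent to the identity. -/
theorem HasStrictFDerivAt.exists_linear_comp {V W : Type*} [NormedAddCommGroup V]
    [NormedSpace ℝ V] [NormedAddCommGroup W] [NormedSpace ℝ W] [FiniteDimensional ℝ W]
    {f : V → W} {L : V →L[ℝ] W} {x : V}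
    (hf : HasStrictFDerivAt f L x) (hL : Function.Surjective L) :
    ∃ Φ : V → V, HasStrictFDerivAt Φ (ContinuousLinearMap.id ℝ V) x ∧ ∀ y, L (Φ y) = f y := by
  obtain ⟨S, hS⟩ := (L : V →ₗ[ℝ] W).exists_rightInverse_of_surjective
    (LinearMap.range_eq_top.2 hL)
  have hS' : ∀ w, L (S w) = w := fun w => LinearMap.congr_fun hS w
  -- With `S` a right inverse of `L`, the correction `S (f y - L y)` has derivative `0` at `x`, and
  -- applying `L` cancels the `L y` terms.
  refine ⟨fun y => y + S.toContinuousLinearMap (f y - L y), ?_, fun y => by simp [hS']⟩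
  have h := (hasStrictFDerivAt_id (𝕜 := ℝ) x).add
    (S.toContinuousLinearMap.hasStrictFDerivAt.comp x (hf.sub L.hasStrictFDerivAt))
  rwa [sub_self, ContinuousLinearMap.comp_zero, add_zero] at h

variable {V W : Type*} [NormedAddCommGroup V] [NormedSpace ℝ V] [FiniteDimensional ℝ V]
  [MeasurableSpace V] [BorelSpace V] [NormedAddCommGroup W] [NormedSpace ℝ W]
  [FiniteDimensional ℝ W] [MeasurableSpace W] [BorelSpace W]

/-- A surjective linear map splits off its kernel, compatibly with Haar measures. -/
theorem ContinuousLinearMap.exists_prod_ker_equiv_measure (L : V →L[ℝ] W)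
    (hL : Function.Surjective L) (μ : Measure V) [μ.IsAddHaarMeasure] (μW : Measure W)
    [μW.IsAddHaarMeasure] :
    ∃ (T : V ≃L[ℝ] W × L.ker) (c : ℝ≥0∞), c ≠ 0 ∧ c ≠ ∞ ∧ (∀ x, (T x).1 = L x) ∧
      ∀ s, μ (T ⁻¹' s) = c * (μW.prod (Measure.addHaar : Measure L.ker)) s := by
  obtain ⟨S, hS⟩ := (L : V →ₗ[ℝ] W).exists_rightInverse_of_surjective
    (LinearMap.range_eq_top.2 hL)
  have hS' : ∀ w, L (S w) = w := fun w => LinearMap.congr_fun hS w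
  let T₀ : V ≃ₗ[ℝ] W × L.ker :=
    { toFun := fun x => (L x, ⟨x - S (L x), by simp [hS']⟩)
      map_add' := fun x y => by
        ext
        · simp
        · simp; abel
      map_smul' := fun a x => by
        ext
        · simp
        · simp [smul_sub]
      invFun := fun p => S p.1 + p.2
      left_inv := fun x => by simp
      right_inv := fun p => by
        have h : L (p.2 : V) = 0 := p.2.2
        ext
        · simp [hS', h]
        · simp [hS', h] }
  let T := T₀.toContinuousLinearEquiv
  have : (μ.map T).IsAddHaarMeasure := T.isAddHaarMeasure_map μ
  refine ⟨T, (μ.map T).addHaarScalarFactor (μW.prod Measure.addHaar), ?_, ENNReal.coe_ne_top,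
    fun x => rfl, fun s => ?_⟩
  · simpa using (Measure.addHaarScalarFactor_pos_of_isAddHaarMeasure (μ.map T)
      (μW.prod Measure.addHaar)).ne'
  · have h := Measure.isAddLeftInvariant_eq_smul (μ.map T)
      (μW.prod (Measure.addHaar : Measure L.ker))
    exact (T.toHomeomorph.toMeasurableEquiv.map_apply s).symm.trans
      (congrArg (fun m : Measure (W × L.ker) => m s) h)

/-- In the splitting `W × ker L` the set lies in a product of `Q` with the bounded shadow of `B` in
the kernel. `Q` need not be measurable. -/
theorem ContinuousLinearMap.measure_inter_preimage_le (L : V →L[ℝ] W)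
    (hL : Function.Surjective L) (μ : Measure V) [μ.IsAddHaarMeasure] (μW : Measure W)
    [μW.IsAddHaarMeasure] {B : Set V} (hB : Bornology.IsBounded B) :
    ∃ C : ℝ≥0∞, C ≠ ∞ ∧ ∀ Q : Set W, μ (B ∩ L ⁻¹' Q) ≤ C * μW Q := by
  obtain ⟨T, c, -, hc, hT, hμ⟩ := L.exists_prod_ker_equiv_measure hL μ μW
  have hK : Bornology.IsBounded ((fun x => (T x).2) '' B) := by
    rw [← image_image (fun p : W × L.ker => p.2) T]
    exact (T.lipschitz.isBounded_image hB).image_snd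
  refine ⟨c * Measure.addHaar ((fun x => (T x).2) '' B),
    ENNReal.mul_ne_top hc hK.measure_lt_top.ne, fun Q => ?_⟩
  calc μ (B ∩ L ⁻¹' Q) ≤ μ (T ⁻¹' (Q ×ˢ ((fun x => (T x).2) '' B))) := by
        refine measure_mono fun x hx => ⟨?_, mem_image_of_mem _ hx.1⟩
        rw [hT]
        exact hx.2
    _ = c * Measure.addHaar ((fun x => (T x).2) '' B) * μW Q := by
        rw [hμ, Measure.prod_prod]
        ring

/-- In the splitting `W × ker L` the neighbourhood `B` contains a product box `N × M`; the fibre `M`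
supplies the constant. -/
theorem ContinuousLinearMap.le_measure_inter_preimage (L : V →L[ℝ] W)
    (hL : Function.Surjective L) (μ : Measure V) [μ.IsAddHaarMeasure] (μW : Measure W)
    [μW.IsAddHaarMeasure] {x : V} {B : Set V} (hB : B ∈ 𝓝 x) :
    ∃ c : ℝ≥0∞, c ≠ 0 ∧ ∃ N ∈ 𝓝 (L x), ∀ Q ⊆ N, c * μW Q ≤ μ (B ∩ L ⁻¹' Q) := by
  obtain ⟨T, c, hc, -, hT, hμ⟩ := L.exists_prod_ker_equiv_measure hL μ μW
  have h1 : T.symm ⁻¹' B ∈ 𝓝 (T x) := by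
    apply T.symm.continuous.continuousAt.preimage_mem_nhds
    simpa using hB
  obtain ⟨N, hN, M, hM, hNM⟩ := mem_nhds_prod_iff.1 h1
  refine ⟨c * Measure.addHaar M, mul_ne_zero hc
    (Measure.measure_pos_of_mem_nhds _ hM).ne', N, ?_, fun Q hQ => ?_⟩
  · rwa [← hT]
  calc c * Measure.addHaar M * μW Q = μ (T ⁻¹' (Q ×ˢ M)) := by
        rw [hμ, Measure.prod_prod]
        ring
    _ ≤ μ (B ∩ L ⁻¹' Q) := by
        refine measure_mono fun y hy => ⟨?_, ?_⟩
        · simpa using hNM (prod_mono hQ subset_rfl hy)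
        · rw [mem_preimage, ← hT]
          exact hy.1

theorem HasStrictFDerivAt.exists_measure_inter_preimage_le {f : V → W} {L : V →L[ℝ] W} {x : V}
    (hf : HasStrictFDerivAt f L x) (hL : Function.Surjective L)
    (μ : Measure V) [μ.IsAddHaarMeasure] (μW : Measure W) [μW.IsAddHaarMeasure] :
    ∃ U ∈ 𝓝 x, ∃ C : ℝ≥0∞, C ≠ ∞ ∧ ∀ Q : Set W, μ (U ∩ f ⁻¹' Q) ≤ C * μW Q := by
  obtain ⟨Φ, hΦ, hLΦ⟩ := hf.exists_linear_comp hL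
  obtain ⟨C, hC, hQ⟩ := L.measure_inter_preimage_le hL μ μW
    (Metric.isBounded_ball (x := Φ x) (r := 1))
  -- Since `Φ` is tangent to the identity, it shrinks volumes near `x` by a factor of at most `2`;
  -- this reduces the estimate for `f = L ∘ Φ` to the linear one.
  have hdet : ((1 / 2 : ℝ≥0) : ℝ≥0∞) < ENNReal.ofReal |(ContinuousLinearMap.id ℝ V).det| := by
    simp [ContinuousLinearMap.det]
  obtain ⟨e, he, he0⟩ := ((mul_le_addHaar_image_of_lt_det μ _ hdet).and
    self_mem_nhdsWithin).exists
  obtain ⟨U, hU, hUΦ⟩ := hΦ.approximates_deriv_on_nhds (c := e) (Or.inr he0)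
  refine ⟨U ∩ Φ ⁻¹' Metric.ball (Φ x) 1, inter_mem hU
    (hΦ.hasFDerivAt.continuousAt.preimage_mem_nhds (Metric.ball_mem_nhds _ one_pos)), 2 * C,
    ENNReal.mul_ne_top (by simp) hC, fun Q => ?_⟩
  have h := (he ((U ∩ Φ ⁻¹' Metric.ball (Φ x) 1) ∩ f ⁻¹' Q) Φ
    (hUΦ.mono_set (fun y hy => hy.1.1))).trans ((measure_mono (t := Metric.ball (Φ x) 1 ∩
      L ⁻¹' Q) (by
        rintro _ ⟨y, hy, rfl⟩
        exact ⟨hy.1.2, by simpa [hLΦ] using hy.2⟩)).trans (hQ Q))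
  rw [mul_assoc]
  refine le_trans (le_of_eq ?_) (mul_le_mul_right h 2)
  rw [← mul_assoc]
  have : (2 : ℝ≥0∞) * ((1 / 2 : ℝ≥0) : ℝ≥0∞) = 1 := by
    norm_cast
    simp
  rw [this, one_mul]

theorem HasStrictFDerivAt.exists_le_measure_inter_preimage {f : V → W} {L : V →L[ℝ] W} {x : V}
    (hf : HasStrictFDerivAt f L x) (hL : Function.Surjective L)
    (μ : Measure V) [μ.IsAddHaarMeasure] (μW : Measure W) [μW.IsAddHaarMeasure]
    {U : Set V} (hU : U ∈ 𝓝 x) :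
    ∃ c : ℝ≥0∞, c ≠ 0 ∧ ∃ N ∈ 𝓝 (f x), ∀ Q ⊆ N, c * μW Q ≤ μ (U ∩ f ⁻¹' Q) := by
  obtain ⟨Φ, hΦ, hLΦ⟩ := hf.exists_linear_comp hL
  have hdet : ENNReal.ofReal |(ContinuousLinearMap.id ℝ V).det| < ((2 : ℝ≥0) : ℝ≥0∞) := by
    simp [ContinuousLinearMap.det]
  obtain ⟨e, he, he0⟩ := ((addHaar_image_le_mul_of_det_lt μ _ hdet).and
    self_mem_nhdsWithin).exists
  obtain ⟨U', hU', hUΦ⟩ := hΦ.approximates_deriv_on_nhds (c := e) (Or.inr he0)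
  -- `Φ` is open at `x`, so the linear lower bound can be applied on the image and pulled back at
  -- the cost of a factor `2`.
  have himg : Φ '' (U ∩ U') ∈ 𝓝 (Φ x) := by
    rw [← hΦ.map_nhds_eq_of_surj (by ext; simp)]
    exact image_mem_map (inter_mem hU hU')
  obtain ⟨c, hc, N, hN, hQ⟩ := L.le_measure_inter_preimage hL μ μW himg
  rw [hLΦ] at hN
  refine ⟨c / 2, by simpa using hc, N, hN, fun Q hQN => ?_⟩
  have h : c * μW Q ≤ 2 * μ (U ∩ f ⁻¹' Q) := by
    refine (hQ Q hQN).trans ?_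
    calc μ (Φ '' (U ∩ U') ∩ L ⁻¹' Q) ≤ μ (Φ '' ((U ∩ U') ∩ f ⁻¹' Q)) := by
          refine measure_mono ?_
          rintro _ ⟨⟨y, hy, rfl⟩, hy2⟩
          exact ⟨y, ⟨hy, by simpa [hLΦ] using hy2⟩, rfl⟩
      _ ≤ 2 * μ ((U ∩ U') ∩ f ⁻¹' Q) := by
          exact_mod_cast he ((U ∩ U') ∩ f ⁻¹' Q) Φ (hUΦ.mono_set (fun y hy => hy.1.2))
      _ ≤ 2 * μ (U ∩ f ⁻¹' Q) := by
          gcongr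
          exact inter_subset_left
  rw [ENNReal.div_eq_inv_mul, mul_assoc, ← ENNReal.div_eq_inv_mul]
  exact ENNReal.div_le_of_le_mul' h

/-- If `f` is a submersion at its zeros in the compact set `K`, then near `0` the image under `f` of
the measure on `K` is bounded by a multiple of Haar measure. -/
theorem IsCompact.exists_measure_inter_preimage_le {f : V → W} {K : Set V} (hK : IsCompact K)
    (hcont : ∀ x ∈ K, ContinuousAt f x)
    (hreg : ∀ x ∈ K, f x = 0 → ∃ L : V →L[ℝ] W, HasStrictFDerivAt f L x ∧ Function.Surjective L)
    (μ : Measure V) [μ.IsAddHaarMeasure] (μW : Measure W) [μW.IsAddHaarMeasure] :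
    ∃ C : ℝ≥0∞, C ≠ ∞ ∧ ∃ N ∈ 𝓝 (0 : W), ∀ Q ⊆ N, μ (K ∩ f ⁻¹' Q) ≤ C * μW Q := by
  refine hK.induction_on (p := fun s => ∃ C : ℝ≥0∞, C ≠ ∞ ∧ ∃ N ∈ 𝓝 (0 : W), ∀ Q ⊆ N,
    μ (s ∩ f ⁻¹' Q) ≤ C * μW Q) ⟨0, by simp, univ, univ_mem, by simp⟩ ?_ ?_ ?_
  · rintro s t hst ⟨C, hC, N, hN, h⟩
    exact ⟨C, hC, N, hN, fun Q hQ => (measure_mono (inter_subset_inter_left _ hst)).trans (h Q hQ)⟩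
  · rintro s t ⟨C, hC, N, hN, h⟩ ⟨C', hC', N', hN', h'⟩
    refine ⟨C + C', ENNReal.add_ne_top.2 ⟨hC, hC'⟩, N ∩ N', inter_mem hN hN', fun Q hQ => ?_⟩
    rw [union_inter_distrib_right, add_mul]
    exact (measure_union_le _ _).trans (add_le_add (h Q (hQ.trans inter_subset_left))
      (h' Q (hQ.trans inter_subset_right)))
  · intro x hx
    by_cases h0 : f x = 0
    · obtain ⟨L, hL, hLs⟩ := hreg x hx h0
      obtain ⟨U, hU, C, hC, h⟩ := hL.exists_measure_inter_preimage_le hLs μ μW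
      exact ⟨U, mem_nhdsWithin_of_mem_nhds hU, C, hC, univ, univ_mem, fun Q _ => h Q⟩
    -- Near a point that is not a zero, `f` stays away from a neighbourhood of `0`, so the preimage
    -- is locally empty and `C = 0` works.
    · obtain ⟨M, hM, N, hN, hMN⟩ := Filter.disjoint_iff.1 (disjoint_nhds_nhds.2 h0)
      refine ⟨f ⁻¹' M, mem_nhdsWithin_of_mem_nhds ((hcont x hx).preimage_mem_nhds hM), 0, by simp,
        N, hN, fun Q hQ => ?_⟩
      rw [← preimage_inter, (hMN.mono_right hQ).inter_eq]
      simp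

end Submersion

/-! ### Norms on `ℝⁿ` under affine maps -/

section Norm

variable {n : ℕ} {ν : Seminorm ℝ (Fin n → ℝ)}

theorem Seminorm.continuous_pi (ν : Seminorm ℝ (Fin n → ℝ)) : Continuous ν := by
  have h : ConvexOn ℝ univ ν := ν.convexOn
  exact h.locallyLipschitz.continuous

theorem Seminorm.exists_mul_norm_le (hν : ∀ x, ν x = 0 → x = 0) :
    ∃ c : ℝ, 0 < c ∧ ∀ x, c * ‖x‖ ≤ ν x := by
  have key : ∃ c : ℝ, 0 < c ∧ ∀ x ∈ Metric.sphere (0 : Fin n → ℝ) 1, c ≤ ν x := by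
    rcases (Metric.sphere (0 : Fin n → ℝ) 1).eq_empty_or_nonempty with h | h
    · exact ⟨1, one_pos, by simp [h]⟩
    · obtain ⟨y, hy, hmin⟩ := (isCompact_sphere (0 : Fin n → ℝ) 1).exists_isMinOn h
        ν.continuous_pi.continuousOn
      refine ⟨ν y, lt_of_le_of_ne (apply_nonneg ν y) fun h0 => ?_, fun x hx => hmin hx⟩
      rw [hν y h0.symm] at hy
      simp at hy
  obtain ⟨c, hc, h⟩ := key
  refine ⟨c, hc, fun x => ?_⟩
  rcases eq_or_ne x 0 with rfl | hx
  · simp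
  · have hx' : 0 < ‖x‖ := norm_pos_iff.2 hx
    have := h (‖x‖⁻¹ • x) (by simp [norm_smul, hx'.ne'])
    rw [map_smul_eq_mul, norm_inv, norm_norm, inv_mul_eq_div, le_div_iff₀ hx'] at this
    exact this

theorem Seminorm.isBounded_setOf_le (hν : ∀ x, ν x = 0 → x = 0) (R : ℝ) :
    Bornology.IsBounded {x | ν x ≤ R} := by
  obtain ⟨c, hc, h⟩ := ν.exists_mul_norm_le hν
  refine (Metric.isBounded_closedBall (x := (0 : Fin n → ℝ)) (r := R / c)).subset fun x hx => ?_
  rw [mem_closedBall_zero_iff, le_div_iff₀ hc, mul_comm]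
  exact (h x).trans hx

theorem finite_integerPoints_inter (hν : ∀ x, ν x = 0 → x = 0) (R : ℝ) :
    (integerPoints n ∩ {x | ν x ≤ R}).Finite := by
  obtain ⟨r, hr⟩ := (ν.isBounded_setOf_le hν R).subset_closedBall 0
  refine ((Set.Finite.pi' fun _ : Fin n => (finite_Icc (-⌈r⌉) ⌈r⌉)).image
    (fun (k : Fin n → ℤ) i => (k i : ℝ))).subset fun x hx => ?_
  choose k hk using hx.1
  refine ⟨k, fun i => ?_, funext fun i => (hk i).symm⟩
  have h1 : |x i| ≤ r := (norm_le_pi_norm x i).trans (by simpa using hr hx.2)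
  rw [hk, abs_le] at h1
  have h2 := Int.le_ceil r
  exact ⟨by exact_mod_cast (neg_le_neg h2).trans h1.1, by exact_mod_cast h1.2.trans h2⟩

theorem ASL.exists_seminorm_smul_le (hν : ∀ x, ν x = 0 → x = 0) (g : ASL n) :
    ∃ C : ℝ, 1 ≤ C ∧ ∀ x, ν (g • x) ≤ C * (ν x + 1) := by
  obtain ⟨c, hc, h⟩ := ν.exists_mul_norm_le hν
  obtain ⟨b, hb, hb'⟩ := ν.bound_of_continuous_normedSpace ν.continuous_pi
  let L := (Matrix.toLin' (g.lin : Matrix (Fin n) (Fin n) ℝ)).toContinuousLinearMap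
  refine ⟨max 1 (max (ν g.trans) (b * ‖L‖ / c)), le_max_left _ _, fun x => ?_⟩
  have h1 : ν (L x) ≤ b * ‖L‖ / c * ν x := by
    calc ν (L x) ≤ b * (‖L‖ * ‖x‖) := (hb' _).trans (by gcongr; exact L.le_opNorm x)
      _ = b * ‖L‖ / c * (c * ‖x‖) := by field_simp
      _ ≤ _ := by gcongr; exact h x
  have h2 : ν (g • x) ≤ ν g.trans + ν (L x) := map_add_le_add ν _ _
  have h3 : b * ‖L‖ / c * ν x ≤ max 1 (max (ν g.trans) (b * ‖L‖ / c)) * ν x :=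
    mul_le_mul_of_nonneg_right ((le_max_right _ _).trans (le_max_right _ _)) (apply_nonneg ν x)
  have h4 : ν g.trans ≤ max 1 (max (ν g.trans) (b * ‖L‖ / c)) :=
    (le_max_left _ _).trans (le_max_right _ _)
  linarith

/-- Away from a bounded set, `ν (g • x)` and `ν x` are comparable. -/
theorem ASL.exists_seminorm_smul_comparable (hν : ∀ x, ν x = 0 → x = 0) (g : ASL n) :
    ∃ C : ℝ, 1 ≤ C ∧ ∀ x, C ≤ ν x → ν (g • x) ≤ C * ν x ∧ ν x ≤ C * ν (g • x) := by
  obtain ⟨C, hC, h⟩ := g.exists_seminorm_smul_le hν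
  obtain ⟨C', hC', h'⟩ := (g⁻¹).exists_seminorm_smul_le hν
  -- This threshold forces both `ν x` and `ν (g • x)` to be at least `1`, so the additive `1` in
  -- each affine bound costs only a factor `2`.
  refine ⟨2 * C * C', by nlinarith, fun x hx => ?_⟩
  have h1 := h x
  have h2 := h' (g • x)
  rw [inv_smul_smul] at h2
  have h0 := apply_nonneg ν (g • x)
  have hx1 : 1 ≤ ν x := by nlinarith
  have hgx : 1 ≤ ν (g • x) := by
    by_contra! hlt
    nlinarith
  constructor
  · calc ν (g • x) ≤ C * (ν x + ν x) := h1.trans (by gcongr)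
      _ = 2 * C * 1 * ν x := by ring
      _ ≤ _ := by gcongr
  · calc ν x ≤ C' * (ν (g • x) + ν (g • x)) := h2.trans (by gcongr)
      _ = 2 * 1 * C' * ν (g • x) := by ring
      _ ≤ _ := by gcongr

end Norm

/-- Iterating the regularity inequality `m` times with `a ^ m > N` upgrades the one dilation `a` to
any dilation `N`, with `β = b ^ m`. -/
theorem IsRegularFun.exists_smul_le {ℓ : ℕ} {ψ : ℝ≥0 → (Fin ℓ → ℝ)} (hψ : IsRegularFun ψ)
    (hψanti : Antitone ψ) (N : ℝ≥0) :
    ∃ β : ℝ, 0 < β ∧ ∀ z : ℝ≥0, 0 < z → β • ψ z ≤ ψ (N * z) := by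
  obtain ⟨-, a, b, ha, hb, h⟩ := hψ
  obtain ⟨m, hm⟩ := pow_unbounded_of_one_lt N ha
  refine ⟨b ^ m, pow_pos hb m, fun z hz => ?_⟩
  refine le_trans ?_ (hψanti (mul_le_mul_left hm.le z))
  clear hm
  induction m with
  | zero => simp
  | succ m ih =>
    calc b ^ (m + 1) • ψ z = b • b ^ m • ψ z := by rw [pow_succ', mul_smul]
      _ ≤ b • ψ (a ^ m * z) := smul_le_smul_of_nonneg_left ih hb.le
      _ ≤ ψ (a * (a ^ m * z)) := h _ (mul_pos (pow_pos (one_pos.trans ha) m) hz)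
      _ = _ := by rw [pow_succ', mul_assoc]

/-! ### Dyadic decomposition of a half-line -/

section Dyadic

theorem monotone_two_pow_add (k₀ : ℕ) : Monotone fun k : ℕ => (2 : ℝ) ^ (k + k₀) :=
  fun _ _ h => pow_le_pow_right₀ one_le_two (by lia)

theorem iUnion_Ioc_two_pow (k₀ : ℕ) :
    ⋃ k : ℕ, Ioc ((2 : ℝ) ^ (k + k₀)) (2 ^ (k + 1 + k₀)) = Ioi (2 ^ k₀) := by
  have h := iUnion_Ioc_map_succ_eq_Ioi (f := fun k : ℕ => (2 : ℝ) ^ (k + k₀))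
    (fun k => monotone_two_pow_add k₀ bot_le)
    (not_bddAbove_of_tendsto_atTop
      ((tendsto_pow_atTop_atTop_of_one_lt one_lt_two).comp (tendsto_add_atTop_nat k₀)))
  simpa using h

theorem pairwise_disjoint_Ioc_two_pow (k₀ : ℕ) :
    Pairwise (Function.onFun Disjoint
      fun k : ℕ => Ioc ((2 : ℝ) ^ (k + k₀)) (2 ^ (k + 1 + k₀))) :=
  (monotone_two_pow_add k₀).pairwise_disjoint_on_Ioc_succ

theorem ENNReal.tsum_add_nat_ne_top_iff {s : ℕ → ℝ≥0∞} (hs : ∀ k, s k ≠ ∞) (k₀ : ℕ) :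
    ∑' k, s (k + k₀) ≠ ∞ ↔ ∑' k, s k ≠ ∞ := by
  induction k₀ with
  | zero => simp
  | succ m ih =>
    rw [← ih, tsum_eq_zero_add' (f := fun k => s (k + m)) ENNReal.summable]
    simp [ENNReal.add_eq_top, hs, add_right_comm, add_assoc]

end Dyadic

/-! ### Volume of a slab in a spherical shell -/

section Shell

variable {n ℓ : ℕ} {ν : Seminorm ℝ (Fin n → ℝ)} {f : (Fin n → ℝ) → (Fin ℓ → ℝ)} {δ : Fin ℓ → ℝ}

/-- The spherical shell `{x : t < ν(x) ≤ 2t}`. -/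
def Seminorm.shell (ν : Seminorm ℝ (Fin n → ℝ)) (t : ℝ) : Set (Fin n → ℝ) :=
  ν ⁻¹' Ioc t (2 * t)

theorem Seminorm.measurableSet_shell (ν : Seminorm ℝ (Fin n → ℝ)) (t : ℝ) :
    MeasurableSet (ν.shell t) :=
  ν.continuous_pi.measurable measurableSet_Ioc

/-- Dilation by `t` moves the problem to the fixed shell of radius `1`; all dependence on `t` goes
into a box that shrinks to `0`. -/
theorem IsHomogeneousOfDegree.shell_inter_preimage (hf : IsHomogeneousOfDegree f δ) {t : ℝ}
    (ht : 0 < t) (ξ ε : Fin ℓ → ℝ) :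
    ν.shell t ∩ f ⁻¹' Icc (ξ - ε) (ξ + ε) =
      t • (ν.shell 1 ∩ f ⁻¹' Icc (fun j => t ^ (-δ j) * (ξ j - ε j))
        (fun j => t ^ (-δ j) * (ξ j + ε j))) := by
  ext x
  have hf' : ∀ j, f (t⁻¹ • x) j = t ^ (-δ j) * f x j := fun j => by
    rw [hf.2.2 t⁻¹ (inv_nonneg.2 ht.le) j x, Real.inv_rpow ht.le, Real.rpow_neg ht.le]
  have hpos : ∀ j, 0 < t ^ (-δ j) := fun j => Real.rpow_pos_of_pos ht _
  rw [mem_smul_set_iff_inv_smul_mem₀ ht.ne']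
  simp only [Seminorm.shell, mem_inter_iff, mem_preimage, mem_Ioc, map_smul_eq_mul, norm_inv,
    Real.norm_of_nonneg ht.le, mem_Icc, Pi.le_def, hf', mul_le_mul_iff_right₀ (hpos _), Pi.sub_apply,
    Pi.add_apply, inv_mul_eq_div, lt_div_iff₀ ht, div_le_iff₀ ht, one_mul, mul_one]

/-- The Jacobian `t ^ n` of the dilation meets the side lengths `2 t ^ (-δ j) ε j`; the exponents
sum to `n - d`, and `ξ` drops out. -/
theorem volume_Icc_rpow_mul {d t : ℝ} (hd : d = ∑ j, δ j) (ht : 0 < t) (ξ ε : Fin ℓ → ℝ) (n : ℕ) :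
    ENNReal.ofReal (t ^ n) * volume (Icc (fun j => t ^ (-δ j) * (ξ j - ε j))
        (fun j => t ^ (-δ j) * (ξ j + ε j))) =
      2 ^ ℓ * (ENNReal.ofReal (t ^ ((n : ℝ) - d)) * ∏ j, ENNReal.ofReal (ε j)) := by
  have h1 : ∀ j, t ^ (-δ j) * (ξ j + ε j) - t ^ (-δ j) * (ξ j - ε j) =
      t ^ (-δ j) * (2 * ε j) := fun j => by ring
  rw [Real.volume_Icc_pi]
  simp_rw [h1, ENNReal.ofReal_mul (Real.rpow_nonneg ht.le _), ENNReal.ofReal_mul zero_le_two,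
    Finset.prod_mul_distrib]
  rw [← ENNReal.ofReal_prod_of_nonneg (fun j _ => Real.rpow_nonneg ht.le _),
    ← Real.rpow_sum_of_pos ht, Finset.sum_neg_distrib, ← hd, sub_eq_add_neg, Real.rpow_add ht,
    Real.rpow_natCast, ENNReal.ofReal_mul (pow_nonneg ht.le _)]
  simp
  ring

theorem IsHomogeneousOfDegree.exists_zero_seminorm_eq (hf : IsHomogeneousOfDegree f δ)
    (hν : ∀ x, ν x = 0 → x = 0) (hZ : (zeroSet f).Nonempty) {R : ℝ} (hR : 0 < R) :
    ∃ x ∈ zeroSet f, ν x = R := by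
  obtain ⟨x, hx, hx0⟩ := hZ
  have hνx : 0 < ν x := lt_of_le_of_ne (apply_nonneg ν x) fun h => hx0 (hν x h.symm)
  have hx' : f x = 0 := hx
  refine ⟨(R / ν x) • x, ⟨?_, ?_⟩, ?_⟩
  · ext j
    rw [hf.2.2 _ (div_pos hR hνx).le, hx']
    simp
  · simpa [hνx.ne', hR.ne'] using hx0
  · rw [map_smul_eq_mul, Real.norm_of_nonneg (div_pos hR hνx).le, div_mul_cancel₀ _ hνx.ne']

/-- The shells of large radius meet the slabs `|f - ξ| ≤ ε` in sets of volume comparable to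
`t ^ (n - d) * ∏ ε_j`. -/
theorem IsHomogeneousOfDegree.exists_volume_shell_bounds (hf : IsHomogeneousOfDegree f δ)
    (hν : ∀ x, ν x = 0 → x = 0) (hfC1 : ContDiffOn ℝ 1 f {0}ᶜ) (hZ : (zeroSet f).Nonempty)
    (hreg : ∀ x ∈ zeroSet f, Function.Surjective (fderiv ℝ f x)) (ξ : Fin ℓ → ℝ) {d : ℝ}
    (hd : d = ∑ j, δ j) :
    ∃ c C : ℝ≥0∞, c ≠ 0 ∧ C ≠ ∞ ∧ ∀ M : ℝ, ∀ᶠ t : ℝ in atTop, ∀ ε : Fin ℓ → ℝ,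
      (∀ j, 0 ≤ ε j) → (∀ j, ε j ≤ M) →
      c * (ENNReal.ofReal (t ^ ((n : ℝ) - d)) * ∏ j, ENNReal.ofReal (ε j)) ≤
        volume (ν.shell t ∩ f ⁻¹' Icc (ξ - ε) (ξ + ε)) ∧
      volume (ν.shell t ∩ f ⁻¹' Icc (ξ - ε) (ξ + ε)) ≤
        C * (ENNReal.ofReal (t ^ ((n : ℝ) - d)) * ∏ j, ENNReal.ofReal (ε j)) := by
  have hC1 : ∀ x ≠ 0, ContDiffAt ℝ 1 f x := fun x hx =>
    hfC1.contDiffAt (isOpen_compl_singleton.mem_nhds hx)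
  have hstrict : ∀ x ≠ 0, HasStrictFDerivAt f (fderiv ℝ f x) x := fun x hx =>
    (hC1 x hx).hasStrictFDerivAt one_ne_zero
  have hK : IsCompact (ν ⁻¹' Icc 1 2) :=
    Metric.isCompact_of_isClosed_isBounded (isClosed_Icc.preimage ν.continuous_pi)
      ((ν.isBounded_setOf_le hν 2).subset fun x hx => hx.2)
  have hK0 : ∀ x ∈ ν ⁻¹' Icc 1 2, x ≠ 0 := by
    rintro x hx rfl
    have := hx.1
    norm_num at this
  obtain ⟨C, hC, N, hN, hupper⟩ := hK.exists_measure_inter_preimage_le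
    (fun x hx => (hC1 x (hK0 x hx)).continuousAt)
    (fun x hx h0 => ⟨_, hstrict x (hK0 x hx), hreg x ⟨h0, hK0 x hx⟩⟩) volume volume
  -- The radius `3 / 2` places a zero of `f` in the interior of the shell, where the local lower
  -- bound applies.
  obtain ⟨z, hz, hνz⟩ := hf.exists_zero_seminorm_eq hν hZ (R := 3 / 2) (by norm_num)
  have hU : ν.shell 1 ∈ 𝓝 z := by
    refine ν.continuous_pi.continuousAt.preimage_mem_nhds (Ioc_mem_nhds ?_ ?_) <;>
      rw [hνz] <;> norm_num
  obtain ⟨c, hc, N', hN', hlower⟩ := (hstrict z hz.2).exists_le_measure_inter_preimage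
    (hreg z hz) volume volume hU
  rw [show f z = 0 from hz.1] at hN'
  obtain ⟨ρ, hρ, hball⟩ := Metric.nhds_basis_closedBall.mem_iff.1 (inter_mem hN hN')
  refine ⟨c * 2 ^ ℓ, C * 2 ^ ℓ, by simp [hc], ENNReal.mul_ne_top hC (by simp), fun M => ?_⟩
  -- Positivity of the degrees makes the rescaled boxes enter any neighbourhood of `0`, uniformly
  -- over `ε ≤ M`.
  have hsmall : ∀ᶠ t : ℝ in atTop, ∀ j, t ^ (-δ j) * (|ξ j| + M) < ρ := by
    refine eventually_all.2 fun j => ?_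
    have := (tendsto_rpow_neg_atTop (hf.2.1 j)).mul_const (|ξ j| + M)
    rw [zero_mul] at this
    exact this.eventually_lt_const hρ
  filter_upwards [hsmall, eventually_gt_atTop 0] with t ht ht0 ε hε hεM
  have hQ : Icc (fun j => t ^ (-δ j) * (ξ j - ε j)) (fun j => t ^ (-δ j) * (ξ j + ε j)) ⊆
      N ∩ N' := by
    refine subset_trans (fun w hw => ?_) hball
    rw [mem_closedBall_zero_iff, pi_norm_le_iff_of_nonneg hρ.le]
    intro j
    have hpos := Real.rpow_pos_of_pos ht0 (-δ j)
    have h1 := hw.1 j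
    have h2 := hw.2 j
    have h3 : t ^ (-δ j) * (ξ j + ε j) ≤ t ^ (-δ j) * (|ξ j| + M) :=
      mul_le_mul_of_nonneg_left (add_le_add (le_abs_self _) (hεM j)) hpos.le
    have h4 : t ^ (-δ j) * -(|ξ j| + M) ≤ t ^ (-δ j) * (ξ j - ε j) :=
      mul_le_mul_of_nonneg_left (by linarith [neg_abs_le (ξ j), hεM j]) hpos.le
    rw [mul_neg] at h4
    have h5 := ht j
    simp only at h1 h2
    rw [Real.norm_eq_abs, abs_le]
    constructor <;> linarith
  have key := volume_Icc_rpow_mul hd ht0 ξ ε n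
  rw [hf.shell_inter_preimage ht0, Measure.addHaar_smul_of_nonneg _ ht0.le, mul_assoc, mul_assoc,
    ← key, Module.finrank_fin_fun]
  constructor
  · rw [mul_left_comm]
    gcongr
    exact hlower _ (hQ.trans inter_subset_right)
  · rw [mul_left_comm C]
    gcongr
    refine (measure_mono (inter_subset_inter_left _ ?_)).trans
      (hupper _ (hQ.trans inter_subset_left))
    exact preimage_mono fun s hs => ⟨hs.1.le, by simpa using hs.2⟩

end Shell

/-! ### Cauchy condensation and the volume of the approximation set -/

section DyadicSum

variable {n ℓ : ℕ} {ν : Seminorm ℝ (Fin n → ℝ)} {f : (Fin n → ℝ) → (Fin ℓ → ℝ)} {δ : Fin ℓ → ℝ}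
  {ψ : ℝ≥0 → (Fin ℓ → ℝ)} {ξ : Fin ℓ → ℝ} {d : ℝ}

/-- The terms `2 ^ (k e) * ∏ ψ_j(2 ^ k)` of the dyadic series. -/
noncomputable def dyadicTerm (ψ : ℝ≥0 → (Fin ℓ → ℝ)) (e : ℝ) (k : ℕ) : ℝ≥0∞ :=
  ENNReal.ofReal (((2 : ℝ) ^ k) ^ e) * ∏ j, ENNReal.ofReal (ψ (2 ^ k) j)

theorem dyadicTerm_ne_top (ψ : ℝ≥0 → (Fin ℓ → ℝ)) (e : ℝ) (k : ℕ) : dyadicTerm ψ e k ≠ ∞ :=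
  ENNReal.mul_ne_top ENNReal.ofReal_ne_top (ENNReal.prod_ne_top fun _ _ => ENNReal.ofReal_ne_top)

theorem ofReal_two_pow_rpow_mul_prod_add (ψ : ℝ≥0 → (Fin ℓ → ℝ)) (e : ℝ) (k m : ℕ) :
    ENNReal.ofReal (((2 : ℝ) ^ k) ^ e) * ∏ j, ENNReal.ofReal (ψ (2 ^ (k + m)) j) =
      ENNReal.ofReal (((2 : ℝ) ^ m) ^ (-e)) * dyadicTerm ψ e (k + m) := by
  rw [dyadicTerm, ← mul_assoc, ← ENNReal.ofReal_mul (by positivity), pow_add (2 : ℝ),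
    Real.mul_rpow (by positivity) (by positivity), mul_left_comm,
    ← Real.rpow_add (by positivity), neg_add_cancel, Real.rpow_zero, mul_one]

theorem ofReal_two_pow_rpow_mul_prod_succ (ψ : ℝ≥0 → (Fin ℓ → ℝ)) (e : ℝ) (k : ℕ) :
    ENNReal.ofReal (((2 : ℝ) ^ k) ^ e) * ∏ j, ENNReal.ofReal (ψ (2 ^ (k + 1)) j) =
      ENNReal.ofReal (2 ^ (-e)) * dyadicTerm ψ e (k + 1) := by
  simpa using ofReal_two_pow_rpow_mul_prod_add ψ e k 1

theorem two_pow_le_toNNReal {k : ℕ} {x : ℝ} (h : (2 : ℝ) ^ k ≤ x) : (2 : ℝ≥0) ^ k ≤ x.toNNReal :=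
  NNReal.le_toNNReal_of_coe_le (by simpa using h)

theorem toNNReal_le_two_pow {k : ℕ} {x : ℝ} (h : x ≤ (2 : ℝ) ^ k) : x.toNNReal ≤ (2 : ℝ≥0) ^ k :=
  Real.toNNReal_le_iff_le_coe.2 (by simpa using h)

/-- Writing `t = u 2^k` with `1 ≤ u ≤ 2`, the constant `2 ^ |p|` covers both signs of `p`. -/
theorem rpow_two_pow_mul_bounds (p : ℝ) (k : ℕ) {t : ℝ} (ht : t ∈ Ioc ((2 : ℝ) ^ k) (2 ^ (k + 1))) :
    2 ^ (-|p|) * ((2 : ℝ) ^ k) ^ p ≤ t ^ p ∧ t ^ p ≤ 2 ^ |p| * ((2 : ℝ) ^ k) ^ p := by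
  have hk : (0 : ℝ) < 2 ^ k := by positivity
  obtain ⟨u, rfl⟩ : ∃ u, t = u * 2 ^ k := ⟨t / 2 ^ k, by field_simp⟩
  have hu1 : 1 ≤ u := by
    have := ht.1
    nlinarith
  have hu2 : u ≤ 2 := by
    have := ht.2
    rw [pow_succ'] at this
    exact le_of_mul_le_mul_right this hk
  rw [Real.mul_rpow (by linarith) hk.le]
  have h1 : u ^ |p| ≤ 2 ^ |p| := Real.rpow_le_rpow (by linarith) hu2 (abs_nonneg p)
  constructor
  · refine mul_le_mul_of_nonneg_right ?_ (Real.rpow_nonneg hk.le _)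
    calc (2 : ℝ) ^ (-|p|) ≤ u ^ (-|p|) := by
          rw [Real.rpow_neg zero_le_two, Real.rpow_neg (by linarith)]
          exact inv_anti₀ (Real.rpow_pos_of_pos (by linarith) _) h1
      _ ≤ u ^ p := Real.rpow_le_rpow_of_exponent_le hu1 (neg_abs_le p)
  · exact mul_le_mul_of_nonneg_right
      ((Real.rpow_le_rpow_of_exponent_le hu1 (le_abs_self p)).trans h1) (Real.rpow_nonneg hk.le _)

theorem lintegral_Ioi_one_eq_tsum (F : ℝ → ℝ≥0∞) :
    ∫⁻ t in Ioi (1 : ℝ), F t = ∑' k : ℕ, ∫⁻ t in Ioc ((2 : ℝ) ^ k) (2 ^ (k + 1)), F t := by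
  have h := iUnion_Ioc_two_pow 0
  simp only [add_zero, pow_zero] at h
  rw [← h, lintegral_iUnion (fun _ => measurableSet_Ioc)
    (by simpa using pairwise_disjoint_Ioc_two_pow 0)]

theorem ofReal_two_pow_rpow_sub_one (e : ℝ) (k : ℕ) :
    ENNReal.ofReal (((2 : ℝ) ^ k) ^ (e - 1)) * volume (Ioc ((2 : ℝ) ^ k) (2 ^ (k + 1))) =
      ENNReal.ofReal (((2 : ℝ) ^ k) ^ e) := by
  rw [Real.volume_Ioc, ← ENNReal.ofReal_mul (by positivity), Real.rpow_sub_one (by positivity)]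
  congr 1
  field_simp
  ring

theorem setLIntegral_Ioc_two_pow_le (hψpos : ∀ t j, 0 < ψ t j) (hψanti : Antitone ψ) (e : ℝ)
    (k : ℕ) :
    ∫⁻ t in Ioc ((2 : ℝ) ^ k) (2 ^ (k + 1)), ENNReal.ofReal (t ^ (e - 1) * ∏ j, ψ t.toNNReal j) ≤
      ENNReal.ofReal (2 ^ |e - 1|) * dyadicTerm ψ e k := by
  calc _ ≤ ∫⁻ _ in Ioc ((2 : ℝ) ^ k) (2 ^ (k + 1)), ENNReal.ofReal (2 ^ |e - 1|) *
          (ENNReal.ofReal (((2 : ℝ) ^ k) ^ (e - 1)) * ∏ j, ENNReal.ofReal (ψ (2 ^ k) j)) := by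
        refine setLIntegral_mono' measurableSet_Ioc fun t ht => ?_
        rw [ENNReal.ofReal_mul' (Finset.prod_nonneg fun j _ => (hψpos _ j).le),
          ENNReal.ofReal_prod_of_nonneg fun j _ => (hψpos _ j).le, ← mul_assoc,
          ← ENNReal.ofReal_mul (by positivity)]
        gcongr with j
        · exact (rpow_two_pow_mul_bounds (e - 1) k ht).2
        · exact hψanti (two_pow_le_toNNReal ht.1.le) j
    _ = _ := by
        rw [setLIntegral_const, dyadicTerm, ← ofReal_two_pow_rpow_sub_one e k]
        ring

/-- `ψ` is smallest at the right endpoint, which is why the term of index `k + 1` appears here,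
against index `k` in the upper bound. -/
theorem le_setLIntegral_Ioc_two_pow (hψpos : ∀ t j, 0 < ψ t j) (hψanti : Antitone ψ) (e : ℝ)
    (k : ℕ) :
    ENNReal.ofReal (2 ^ (-|e - 1|)) * (ENNReal.ofReal (2 ^ (-e)) * dyadicTerm ψ e (k + 1)) ≤
      ∫⁻ t in Ioc ((2 : ℝ) ^ k) (2 ^ (k + 1)),
        ENNReal.ofReal (t ^ (e - 1) * ∏ j, ψ t.toNNReal j) := by
  calc _ = ∫⁻ _ in Ioc ((2 : ℝ) ^ k) (2 ^ (k + 1)), ENNReal.ofReal (2 ^ (-|e - 1|)) *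
          (ENNReal.ofReal (((2 : ℝ) ^ k) ^ (e - 1)) *
            ∏ j, ENNReal.ofReal (ψ (2 ^ (k + 1)) j)) := by
        rw [setLIntegral_const, ← ofReal_two_pow_rpow_mul_prod_succ, ← ofReal_two_pow_rpow_sub_one e k]
        ring
    _ ≤ _ := by
        refine setLIntegral_mono' measurableSet_Ioc fun t ht => ?_
        rw [ENNReal.ofReal_mul' (Finset.prod_nonneg fun j _ => (hψpos _ j).le),
          ENNReal.ofReal_prod_of_nonneg fun j _ => (hψpos _ j).le, ← mul_assoc,
          ← ENNReal.ofReal_mul (by positivity)]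
        gcongr with j
        · exact (rpow_two_pow_mul_bounds (e - 1) k ht).1
        · exact hψanti (toNNReal_le_two_pow ht.2) j

/-- Cauchy condensation for the integral of `t ^ (e - 1) * ∏ ψ_j(t)`. -/
theorem lintegral_ne_top_iff_tsum_dyadicTerm (hψpos : ∀ t j, 0 < ψ t j) (hψanti : Antitone ψ)
    (e : ℝ) :
    ∫⁻ t in Ioi (1 : ℝ), ENNReal.ofReal (t ^ (e - 1) * ∏ j, ψ t.toNNReal j) ≠ ∞ ↔
      ∑' k, dyadicTerm ψ e k ≠ ∞ := by
  rw [lintegral_Ioi_one_eq_tsum]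
  constructor
  · intro h
    rw [← ENNReal.tsum_add_nat_ne_top_iff (dyadicTerm_ne_top ψ e) 1]
    intro htop
    refine h (top_le_iff.1 (le_trans ?_ (ENNReal.tsum_le_tsum
      fun k => le_setLIntegral_Ioc_two_pow hψpos hψanti e k)))
    rw [ENNReal.tsum_mul_left, ENNReal.tsum_mul_left, htop, ENNReal.mul_top, ENNReal.mul_top]
    · simpa using Real.rpow_pos_of_pos two_pos _
    · simpa using Real.rpow_pos_of_pos two_pos _
  · intro h
    refine ne_top_of_le_ne_top ?_ (ENNReal.tsum_le_tsum
      fun k => setLIntegral_Ioc_two_pow_le hψpos hψanti e k)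
    rw [ENNReal.tsum_mul_left]
    exact ENNReal.mul_ne_top ENNReal.ofReal_ne_top h

theorem measurableSet_approxSet {F : (Fin n → ℝ) → (Fin ℓ → ℝ)} (hF : Measurable F)
    (hψ : Measurable ψ) (ν : Seminorm ℝ (Fin n → ℝ)) : MeasurableSet (approxSet F ψ ν) := by
  have hν : Measurable ν := ν.continuous_pi.measurable
  have : approxSet F ψ ν = ⋂ j, {x | |F x j| ≤ ψ (ν x).toNNReal j} := by
    ext x
    simp [approxSet]
  rw [this]
  refine MeasurableSet.iInter fun j => measurableSet_le ?_ ?_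
  · exact ((measurable_pi_apply j).comp hF).abs
  · exact (measurable_pi_apply j).comp (hψ.comp hν.real_toNNReal)

theorem Seminorm.iUnion_shell_two_pow (ν : Seminorm ℝ (Fin n → ℝ)) (k₀ : ℕ) :
    ⋃ k : ℕ, ν.shell (2 ^ (k + k₀)) = {x | 2 ^ k₀ < ν x} := by
  have h := congrArg (ν ⁻¹' ·) (iUnion_Ioc_two_pow k₀)
  simp only [preimage_iUnion, add_right_comm _ 1 k₀] at h
  simp only [Seminorm.shell, ← pow_succ']
  exact h

theorem Seminorm.pairwise_disjoint_shell_two_pow (ν : Seminorm ℝ (Fin n → ℝ)) (k₀ : ℕ) :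
    Pairwise (Function.onFun Disjoint fun k : ℕ => ν.shell (2 ^ (k + k₀))) := by
  intro i j hij
  have h := (pairwise_disjoint_Ioc_two_pow k₀ hij).preimage ν
  simpa only [Function.onFun, Seminorm.shell, ← pow_succ', add_right_comm] using h

theorem prod_ofReal_mul {M : ℝ} (hM : 0 ≤ M) (w : Fin ℓ → ℝ) :
    ∏ j, ENNReal.ofReal ((M • w) j) = ENNReal.ofReal M ^ ℓ * ∏ j, ENNReal.ofReal (w j) := by
  simp [ENNReal.ofReal_mul hM, Finset.prod_mul_distrib]

theorem mem_Icc_iff_abs_shifted_le {x : Fin n → ℝ} {ε : Fin ℓ → ℝ} :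
    x ∈ f ⁻¹' Icc (ξ - ε) (ξ + ε) ↔ ∀ j, |shifted ξ f x j| ≤ ε j := by
  simp only [mem_preimage, mem_Icc, Pi.le_def, ← forall_and, shifted, Pi.sub_apply, Pi.add_apply,
    Pi.neg_apply, abs_le]
  refine forall_congr' fun j => ?_
  constructor <;> rintro ⟨h1, h2⟩ <;> constructor <;> linarith

theorem antitone_apply_le (hψanti : Antitone ψ) (t : ℝ≥0) (j : Fin ℓ) : ψ t j ≤ ‖ψ 0‖ :=
  (hψanti zero_le j).trans ((le_abs_self _).trans (norm_le_pi_norm (ψ 0) j))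

/-- The volume of `{|f - ξ| ≤ M ψ(ν)}` is finite if and only if the dyadic series converges. -/
theorem IsHomogeneousOfDegree.volume_approxSet_ne_top_iff (hf : IsHomogeneousOfDegree f δ)
    (hν : ∀ x, ν x = 0 → x = 0) (hfC1 : ContDiffOn ℝ 1 f {0}ᶜ) (hZ : (zeroSet f).Nonempty)
    (hreg : ∀ x ∈ zeroSet f, Function.Surjective (fderiv ℝ f x)) (ξ : Fin ℓ → ℝ)
    (hd : d = ∑ j, δ j) (hψ : Measurable ψ) (hψpos : ∀ t j, 0 < ψ t j) (hψanti : Antitone ψ)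
    {M : ℝ} (hM : 0 < M) :
    volume (approxSet (shifted ξ f) (M • ψ) ν) ≠ ∞ ↔ ∑' k, dyadicTerm ψ ((n : ℝ) - d) k ≠ ∞ := by
  obtain ⟨c, C, hc, hC, hbounds⟩ := hf.exists_volume_shell_bounds hν hfC1 hZ hreg ξ hd
  obtain ⟨k₀, hk₀⟩ := eventually_atTop.1
    ((tendsto_pow_atTop_atTop_of_one_lt (one_lt_two (α := ℝ))).eventually (hbounds (M * ‖ψ 0‖)))
  set A := approxSet (shifted ξ f) (M • ψ) ν
  have hAm : MeasurableSet A :=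
    measurableSet_approxSet (hf.1.const_add (-ξ)) (hψ.const_smul M) ν
  have hψM : ∀ t j, 0 ≤ (M • ψ t) j := fun t j => (mul_pos hM (hψpos t j)).le
  have hψM' : ∀ t j, (M • ψ t) j ≤ M * ‖ψ 0‖ := fun t j =>
    mul_le_mul_of_nonneg_left (antitone_apply_le hψanti t j) hM.le
  have hMℓ : ENNReal.ofReal M ^ ℓ ≠ 0 := by simp [hM]
  rw [← ENNReal.tsum_add_nat_ne_top_iff (dyadicTerm_ne_top ψ _) k₀]
  constructor
  · intro h htop
    -- The lower bound on a shell uses `ψ` at its outer radius, so the series is needed with one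
    -- further shift of the index.
    have htop' : ∑' k, dyadicTerm ψ ((n : ℝ) - d) (k + 1 + k₀) = ∞ := by
      by_contra hne
      exact (ENNReal.tsum_add_nat_ne_top_iff
        (fun k => dyadicTerm_ne_top ψ ((n : ℝ) - d) (k + k₀)) 1).1 hne htop
    have hsub : ⋃ k : ℕ, (ν.shell (2 ^ (k + k₀)) ∩ A) ⊆ A :=
      iUnion_subset fun k => inter_subset_right
    have hvol := measure_mono (μ := volume) hsub
    rw [measure_iUnion (fun i j hij => ((ν.pairwise_disjoint_shell_two_pow k₀ hij).mono
      inter_subset_left inter_subset_left)) fun k => (ν.measurableSet_shell _).inter hAm] at hvol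
    have hle : ∑' k : ℕ, c * (ENNReal.ofReal (((2 : ℝ) ^ (k + k₀)) ^ ((n : ℝ) - d)) *
        ∏ j, ENNReal.ofReal ((M • ψ (2 ^ (k + k₀ + 1))) j)) ≤
          ∑' k : ℕ, volume (ν.shell (2 ^ (k + k₀)) ∩ A) := ENNReal.tsum_le_tsum fun k => ?_
    refine h (top_le_iff.1 (le_trans ?_ (hle.trans hvol)))
    · simp_rw [prod_ofReal_mul hM.le, mul_left_comm _ (ENNReal.ofReal M ^ ℓ),
        ofReal_two_pow_rpow_mul_prod_succ]
      simp_rw [ENNReal.tsum_mul_left, add_right_comm _ k₀ 1, htop']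
      rw [ENNReal.mul_top, ENNReal.mul_top hc, ENNReal.mul_top hMℓ]
      simpa using Real.rpow_pos_of_pos two_pos _
    · refine (hk₀ (k + k₀) (Nat.le_add_left _ _) _ (hψM _) (hψM' _)).1.trans
        (measure_mono fun x hx => ⟨hx.1, fun j => ?_⟩)
      refine (mem_Icc_iff_abs_shifted_le.1 hx.2 j).trans ?_
      refine mul_le_mul_of_nonneg_left (hψanti (toNNReal_le_two_pow ?_) j) hM.le
      rw [pow_succ']
      exact hx.1.2
  · intro h
    have hcover : A ⊆ {x | ν x ≤ 2 ^ k₀} ∪ ⋃ k : ℕ, (ν.shell (2 ^ (k + k₀)) ∩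
        f ⁻¹' Icc (ξ - M • ψ (2 ^ (k + k₀))) (ξ + M • ψ (2 ^ (k + k₀)))) := by
      intro x hx
      rcases le_or_gt (ν x) (2 ^ k₀) with hle | hlt
      · exact Or.inl hle
      · right
        have hx' : x ∈ ⋃ k : ℕ, ν.shell (2 ^ (k + k₀)) := by
          rw [ν.iUnion_shell_two_pow]
          exact hlt
        obtain ⟨k, hk⟩ := mem_iUnion.1 hx'
        refine mem_iUnion.2 ⟨k, hk, mem_Icc_iff_abs_shifted_le.2 fun j => (hx j).trans ?_⟩
        exact mul_le_mul_of_nonneg_left (hψanti (two_pow_le_toNNReal hk.1.le) j) hM.le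
    refine ne_top_of_le_ne_top ?_ ((measure_mono hcover).trans ((measure_union_le _ _).trans
      (add_le_add_right ((measure_iUnion_le _).trans (ENNReal.tsum_le_tsum fun k =>
        (hk₀ (k + k₀) (Nat.le_add_left _ _) _ (hψM _) (hψM' _)).2)) _)))
    refine ENNReal.add_ne_top.2 ⟨(ν.isBounded_setOf_le hν _).measure_lt_top.ne, ?_⟩
    simp_rw [prod_ofReal_mul hM.le]
    rw [ENNReal.tsum_mul_left]
    refine ENNReal.mul_ne_top hC ?_
    simp_rw [mul_left_comm _ (ENNReal.ofReal M ^ ℓ)]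
    rw [ENNReal.tsum_mul_left]
    exact ENNReal.mul_ne_top (by simp) h

end DyadicSum

/-! ### From `H ⧸ Γ` to `H` -/

section Quotient

variable {H : Type*} [Group H] (Γ : Subgroup H)

/-- The sum of `F` over the fibres of `H → H ⧸ Γ`. -/
noncomputable def fiberSum (F : H → ℝ≥0∞) (x : H ⧸ Γ) : ℝ≥0∞ := ∑' γ : Γ, F (x.out * γ)

theorem fiberSum_mk (F : H → ℝ≥0∞) (g : H) : fiberSum Γ F (g : H ⧸ Γ) = ∑' γ : Γ, F (g * γ) := by
  obtain ⟨γ₀, hγ₀⟩ := QuotientGroup.mk_out_eq_mul Γ g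
  rw [fiberSum, hγ₀, ← (Equiv.mulLeft γ₀).tsum_eq fun γ : Γ => F (g * γ)]
  simp [mul_assoc]

/-- Discreteness gives a neighbourhood `O` of `1` meeting `Γ` only in `1`. If `U⁻¹ U ⊆ O`, each
coset meets `U` at most once. This makes the lifted measure locally finite. -/
theorem Subgroup.exists_isOpen_fiberSum_le_one [TopologicalSpace H] [IsTopologicalGroup H]
    [DiscreteTopology Γ] :
    ∃ U : Set H, IsOpen U ∧ 1 ∈ U ∧ ∀ x, fiberSum Γ (U.indicator 1) x ≤ 1 := by
  obtain ⟨O, hO, hOΓ⟩ := isOpen_induced_iff.1 (isOpen_discrete ({1} : Set Γ))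
  have h1 : (1 : H) ∈ O := by
    have : (1 : Γ) ∈ ((↑) : Γ → H) ⁻¹' O := by rw [hOΓ]; rfl
    simpa using this
  have hcont : ContinuousAt (fun p : H × H => p.1⁻¹ * p.2) (1, 1) := by fun_prop
  have hmem : (fun p : H × H => p.1⁻¹ * p.2) ⁻¹' O ∈ 𝓝 ((1 : H), (1 : H)) :=
    hcont.preimage_mem_nhds (hO.mem_nhds (by simpa using h1))
  obtain ⟨U, V, hU, h1U, hV, h1V, hUV⟩ := mem_nhds_prod_iff'.1 hmem
  refine ⟨U ∩ V, hU.inter hV, ⟨h1U, h1V⟩, fun x => ?_⟩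
  rw [fiberSum]
  by_cases hex : ∃ γ : Γ, x.out * γ ∈ U ∩ V
  · obtain ⟨γ, hγ⟩ := hex
    rw [tsum_eq_single γ]
    · exact indicator_le_self' (fun _ _ => zero_le) _
    · intro γ' hγ'
      refine indicator_of_notMem (fun hmem' => hγ' ?_) _
      have h2 : (γ⁻¹ * γ' : Γ) ∈ ((↑) : Γ → H) ⁻¹' O := by
        have := hUV (mk_mem_prod hγ.1 hmem'.2)
        simpa [mul_assoc] using this
      rw [hOΓ, mem_singleton_iff, inv_mul_eq_one] at h2
      exact h2.symm
  · push Not at hex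
    rw [tsum_congr fun γ => indicator_of_notMem (hex γ) _]
    simp

variable [TopologicalSpace H] [IsTopologicalGroup H] [MeasurableSpace H] [BorelSpace H]

theorem measurable_fiberSum [Countable Γ] {F : H → ℝ≥0∞} (hF : Measurable F) :
    Measurable (fiberSum Γ F) := by
  rw [QuotientGroup.measurable_from_quotient]
  have : fiberSum Γ F ∘ ((↑) : H → H ⧸ Γ) = fun g => ∑' γ : Γ, F (g * γ) :=
    funext fun g => fiberSum_mk Γ F g
  rw [this]
  exact Measurable.tsum fun γ => hF.comp (measurable_mul_const _)

/-- A measure on `H ⧸ Γ` lifts to `H` by integrating the counting measures of the fibres. -/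
theorem exists_measure_eq_lintegral_fiberSum [Countable Γ] (μX : Measure (H ⧸ Γ)) :
    ∃ m : Measure H, ∀ A, MeasurableSet A → m A = ∫⁻ x, fiberSum Γ (A.indicator 1) x ∂μX := by
  refine ⟨Measure.ofMeasurable (fun A _ => ∫⁻ x, fiberSum Γ (A.indicator 1) x ∂μX)
    (by simp [fiberSum]) fun A hA hd => ?_, fun A hA => Measure.ofMeasurable_apply A hA⟩
  rw [← lintegral_tsum fun i =>
    (measurable_fiberSum Γ (measurable_one.indicator (hA i))).aemeasurable]
  refine lintegral_congr fun x => ?_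
  simp only [fiberSum]
  rw [ENNReal.tsum_comm]
  refine tsum_congr fun γ => ?_
  have h := measure_iUnion (μ := Measure.dirac (x.out * (γ : H))) hd hA
  rw [Measure.dirac_apply' _ (MeasurableSet.iUnion hA)] at h
  simpa only [Measure.dirac_apply' _ (hA _)] using h

/-- A property that holds almost everywhere on `H ⧸ Γ`, for a finite invariant measure, holds Haar
almost everywhere on `H`. -/
theorem ae_of_ae_quotient [SecondCountableTopology H] [DiscreteTopology Γ] (μX : Measure (H ⧸ Γ)) [IsProbabilityMeasure μX]
    [SMulInvariantMeasure H (H ⧸ Γ) μX] (μ : Measure H) [SFinite μ] [μ.IsMulLeftInvariant]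
    {p : H ⧸ Γ → Prop} (h : ∀ᵐ x ∂μX, p x) : ∀ᵐ g : H ∂μ, p (g : H ⧸ Γ) := by
  have : Countable Γ := countable_of_Lindelof_of_discrete
  have hmk : Measurable ((↑) : H → H ⧸ Γ) := QuotientGroup.measurable_coe
  have hsm : MeasurableConstSMul H (H ⧸ Γ) := ⟨fun g => by
    rw [QuotientGroup.measurable_from_quotient]
    exact hmk.comp (measurable_const_mul g)⟩
  obtain ⟨m, hm⟩ := exists_measure_eq_lintegral_fiberSum Γ μX
  have hinv : m.IsMulLeftInvariant := ⟨fun g => by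
    ext A hA
    rw [Measure.map_apply (measurable_const_mul g) hA, hm A hA,
      hm _ (measurable_const_mul g hA), ← (measurePreserving_smul g μX).lintegral_comp
        (measurable_fiberSum Γ (measurable_one.indicator hA))]
    refine lintegral_congr fun x => ?_
    induction x using QuotientGroup.induction_on with
    | H a =>
      rw [MulAction.Quotient.smul_coe, fiberSum_mk, fiberSum_mk]
      simp only [smul_eq_mul, mul_assoc]
      rfl⟩
  have hne : m ≠ 0 := by
    rintro rfl
    have h1 := hm univ MeasurableSet.univ
    have h2 : (1 : ℝ≥0∞) ≤ ∫⁻ x, fiberSum Γ (univ.indicator 1) x ∂μX := by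
      calc (1 : ℝ≥0∞) = ∫⁻ _, 1 ∂μX := by simp
        _ ≤ _ := by
          refine lintegral_mono fun x => ?_
          rw [fiberSum]
          exact le_trans (by simp) (ENNReal.le_tsum (1 : Γ))
    rw [← h1] at h2
    simp at h2
  have hfin : IsLocallyFiniteMeasure m := ⟨fun x => by
    obtain ⟨U, hU, h1U, hle⟩ := Γ.exists_isOpen_fiberSum_le_one
    refine ⟨(x⁻¹ * ·) ⁻¹' U, (hU.preimage (continuous_const_mul _)).mem_nhds (by simpa), ?_⟩
    rw [measure_preimage_mul, hm U hU.measurableSet]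
    calc _ ≤ ∫⁻ _, 1 ∂μX := lintegral_mono hle
      _ < ∞ := by simp⟩
  -- The lift `m` is a nonzero left-invariant measure, so its null sets are null for `μ`; no
  -- normalization is needed.
  have hac : μ ≪ m := absolutelyContinuous_of_isMulLeftInvariant μ m hne
  -- The exceptional set need not be measurable, so it is enlarged to a measurable null set before
  -- lifting.
  set N := toMeasurable μX {x | ¬ p x}
  have hN0 : μX N = 0 := by
    rw [measure_toMeasurable]
    exact h
  have hNm : MeasurableSet (((↑) : H → H ⧸ Γ) ⁻¹' N) := hmk (measurableSet_toMeasurable _ _)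
  have hm0 : m (((↑) : H → H ⧸ Γ) ⁻¹' N) = 0 := by
    rw [hm _ hNm]
    refine (lintegral_eq_zero_iff (measurable_fiberSum Γ (measurable_one.indicator hNm))).2 ?_
    have hN : ∀ᵐ x ∂μX, x ∉ N := measure_eq_zero_iff_ae_notMem.1 hN0
    filter_upwards [hN] with x hx
    induction x using QuotientGroup.induction_on with
    | H a =>
      rw [fiberSum_mk]
      simp only [Pi.zero_apply, ENNReal.tsum_eq_zero]
      refine fun γ => indicator_of_notMem (fun hmem => hx ?_) _
      rwa [mem_preimage, QuotientGroup.mk_mul_of_mem a γ.2] at hmem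
  refine measure_mono_null (fun g hg => ?_) (hac hm0)
  exact subset_toMeasurable μX _ hg

end Quotient

/-! ### Topology of `ASL_n(ℝ)` -/

section ASLInstances

variable {n : ℕ}

theorem ASL.isClosedEmbedding_prod :
    Topology.IsClosedEmbedding fun g : ASL n => ((g.lin : Matrix (Fin n) (Fin n) ℝ), g.trans) := by
  have h1 : Topology.IsClosedEmbedding
      (Subtype.val : Matrix.SpecialLinearGroup (Fin n) ℝ → Matrix (Fin n) (Fin n) ℝ) := by
    refine Topology.IsClosedEmbedding.subtypeVal ?_
    exact isClosed_eq (continuous_id.matrix_det) continuous_const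
  have h2 : Topology.IsClosedEmbedding fun g : ASL n => (g.lin, g.trans) := by
    refine ⟨⟨ASL.isInducing_prod, fun g g' h => ?_⟩, ?_⟩
    · exact ASL.ext (congrArg Prod.fst h) (congrArg Prod.snd h)
    · rw [Set.range_eq_univ.2 fun p => ⟨⟨p.1, p.2⟩, rfl⟩]
      exact isClosed_univ
  exact (h1.prodMap Topology.IsClosedEmbedding.id).comp h2

instance : SecondCountableTopology (ASL n) :=
  have : SecondCountableTopology (Matrix (Fin n) (Fin n) ℝ) :=
    inferInstanceAs (SecondCountableTopology (Fin n → Fin n → ℝ))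
  ASL.isClosedEmbedding_prod.isEmbedding.secondCountableTopology

instance : SigmaCompactSpace (ASL n) :=
  have : SigmaCompactSpace (Matrix (Fin n) (Fin n) ℝ) :=
    inferInstanceAs (SigmaCompactSpace (Fin n → Fin n → ℝ))
  ASL.isClosedEmbedding_prod.sigmaCompactSpace

theorem ASL.continuous_smul_vec (x : Fin n → ℝ) : Continuous fun g : ASL n => g • x :=
  ASL.continuous_trans.add
    ((continuous_subtype_val.comp ASL.continuous_lin).matrix_mulVec continuous_const)

end ASLInstances

/-! ### Counting lattice points: first moment, Chebyshev, Borel–Cantelli -/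

section Siegel

variable {n : ℕ} {G : Subgroup (ASL n)} {P : Set (Fin n → ℝ)} {μX : Measure (CosetSpace G P)}

theorem siegelTransform_mk (f : (Fin n → ℝ) → ℝ≥0) (g : G) :
    siegelTransform G P f (g : CosetSpace G P) = ∑' v : P, (f (g • (v : Fin n → ℝ)) : ℝ≥0∞) :=
  rfl

theorem siegelTransform_indicator_mk (E : Set (Fin n → ℝ)) (g : G) :
    siegelTransform G P (E.indicator 1) (g : CosetSpace G P) =
      ({v ∈ P | g • v ∈ E}.encard : ℝ≥0∞) := by
  rw [siegelTransform_mk, ← ENNReal.tsum_set_one, tsum_subtype P fun v =>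
    ((E.indicator 1 (g • v) : ℝ≥0) : ℝ≥0∞), tsum_subtype {v ∈ P | g • v ∈ E} fun _ => 1]
  refine tsum_congr fun v => ?_
  by_cases hv : v ∈ P <;> by_cases hE : g • v ∈ E <;> simp [hv, hE]

theorem countable_of_subset_integerPoints (hP : P ⊆ integerPoints n) : P.Countable := by
  refine ((countable_univ (α := Fin n → ℤ)).image fun k i => (k i : ℝ)).mono fun x hx => ?_
  choose k hk using hP hx
  exact ⟨k, mem_univ k, funext fun i => (hk i).symm⟩

theorem measurable_siegelTransform (hP : P.Countable) {f : (Fin n → ℝ) → ℝ≥0}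
    (hf : Measurable f) : Measurable (siegelTransform G P f) := by
  have := hP.to_subtype
  rw [QuotientGroup.measurable_from_quotient]
  change Measurable fun g : G => ∑' v : P, (f (g • (v : Fin n → ℝ)) : ℝ≥0∞)
  refine Measurable.tsum fun v => (hf.comp ?_).coe_nnreal_ennreal
  exact ((ASL.continuous_smul_vec (v : Fin n → ℝ)).comp continuous_subtype_val).measurable

theorem IsSiegelType.exists_lintegral_indicator (h : IsSiegelType G P μX) :
    ∃ c : ℝ≥0, 0 < c ∧ ∀ E : Set (Fin n → ℝ), MeasurableSet E → Bornology.IsBounded E →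
      ∫⁻ x, siegelTransform G P (E.indicator 1) x ∂μX = c * volume E := by
  obtain ⟨c, hc, h⟩ := h
  refine ⟨c, hc, fun E hE hb => ?_⟩
  rw [h (E.indicator 1) (measurable_one.indicator hE)
    ⟨1, fun x => indicator_le_self' (fun _ _ => zero_le) x⟩
    (HasCompactSupport.of_support_subset_isCompact hb.isCompact_closure
      (support_indicator_subset.trans subset_closure))]
  congr 1
  rw [← lintegral_indicator_one hE]
  refine lintegral_congr fun x => ?_
  by_cases hx : x ∈ E <;> simp [hx]

/-- If `A` has finite volume, almost every `gP` has finitely many points in `A`. -/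
theorem IsSiegelType.ae_siegelTransform_ne_top (h : IsSiegelType G P μX) (hP : P.Countable)
    {A : Set (Fin n → ℝ)} (hA : MeasurableSet A) (hvol : volume A ≠ ∞) :
    ∀ᵐ x ∂μX, siegelTransform G P (A.indicator 1) x ≠ ∞ := by
  obtain ⟨c, -, hc⟩ := h.exists_lintegral_indicator
  -- The Siegel formula is available only for bounded sets, so `A` is cut into disjoint bounded
  -- annuli and the means are summed.
  let D : ℕ → Set (Fin n → ℝ) := fun k => A ∩ {x | ⌊‖x‖⌋₊ = k}
  have hDm : ∀ k, MeasurableSet (D k) := fun k =>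
    hA.inter ((Nat.measurable_floor.comp measurable_norm) (measurableSet_singleton k))
  have hDb : ∀ k, Bornology.IsBounded (D k) := fun k => by
    refine (Metric.isBounded_ball (x := (0 : Fin n → ℝ)) (r := k + 1)).subset fun x hx => ?_
    have hx2 : ⌊‖x‖⌋₊ = k := hx.2
    rw [mem_ball_zero_iff, ← hx2]
    exact Nat.lt_floor_add_one _
  have hDd : Pairwise (Function.onFun Disjoint D) := fun i j hij =>
    disjoint_left.2 fun x hi hj => hij (hi.2.symm.trans hj.2)
  have hDU : ⋃ k, D k ⊆ A := iUnion_subset fun k => inter_subset_left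
  have hint : ∫⁻ x, ∑' k, siegelTransform G P ((D k).indicator 1) x ∂μX ≠ ∞ := by
    rw [lintegral_tsum fun k => (measurable_siegelTransform hP
      (measurable_one.indicator (hDm k))).aemeasurable]
    simp_rw [hc _ (hDm _) (hDb _)]
    rw [ENNReal.tsum_mul_left, ← measure_iUnion hDd hDm]
    exact ENNReal.mul_ne_top ENNReal.coe_ne_top (ne_top_of_le_ne_top hvol (measure_mono hDU))
  filter_upwards [ae_lt_top' (AEMeasurable.tsum fun k => (measurable_siegelTransform hP
    (measurable_one.indicator (hDm k))).aemeasurable) hint] with x hx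
  refine ne_top_of_le_ne_top hx.ne ?_
  induction x using QuotientGroup.induction_on with
  | H g =>
    simp_rw [siegelTransform_mk]
    rw [ENNReal.tsum_comm]
    refine ENNReal.tsum_le_tsum fun v => ?_
    by_cases hv : g • (v : Fin n → ℝ) ∈ A
    · refine le_trans ?_ (ENNReal.le_tsum ⌊‖g • (v : Fin n → ℝ)‖⌋₊)
      simp [D, hv]
    · simp [hv]

/-- Chebyshev's inequality for the Siegel transform. -/
theorem IsRogersType.exists_measure_siegelTransform_le (hS : IsSiegelType G P μX) {r : ℝ}
    (hr : 1 < r) (hR : IsRogersType G P r μX) (hP : P.Countable) :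
    ∃ κ K : ℝ≥0∞, κ ≠ 0 ∧ K ≠ ∞ ∧ ∀ E : Set (Fin n → ℝ), MeasurableSet E →
      Bornology.IsBounded E → 0 < volume E →
      μX {x | siegelTransform G P (E.indicator 1) x ≤ κ * volume E} ≤
        K * volume E ^ (1 - r) := by
  obtain ⟨c, hc0, hc⟩ := hS.exists_lintegral_indicator
  obtain ⟨D, -, hD⟩ := hR
  have hr0 : 0 < r := one_pos.trans hr
  have hκ0 : ((c / 2 : ℝ≥0) : ℝ≥0∞) ≠ 0 := by simpa using hc0.ne'
  -- A count of at most half the mean `c · m(E)` deviates from it by at least `(c / 2) m(E)`.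
  -- Dividing the `r`-th moment bound `D ^ r m(E)` by the `r`-th power of this gives `K m(E) ^ (1 -
  -- r)`.
  refine ⟨(c / 2 : ℝ≥0), ((c / 2 : ℝ≥0) : ℝ≥0∞)⁻¹ ^ r * (D : ℝ≥0∞) ^ r, hκ0,
    ENNReal.mul_ne_top (ENNReal.rpow_ne_top_of_nonneg hr0.le (by simpa using hc0.ne'))
      (ENNReal.rpow_ne_top_of_nonneg hr0.le ENNReal.coe_ne_top), fun E hE hb hpos => ?_⟩
  have hvt : volume E ≠ ∞ := hb.measure_lt_top.ne
  obtain ⟨-, hD⟩ := hD E hE hb hpos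
  rw [hc E hE hb] at hD
  have hr' : (ENNReal.ofReal r).toReal = r := ENNReal.toReal_ofReal hr0.le
  have hmeas := (measurable_siegelTransform (G := G) hP (measurable_one.indicator hE))
  have key := meas_ge_le_mul_pow_eLpNorm_enorm μX (p := ENNReal.ofReal r) (by simpa using hr0)
    ENNReal.ofReal_ne_top (f := fun x => (siegelTransform G P (E.indicator 1) x).toReal -
        (c * volume E).toReal) (hmeas.ennreal_toReal.sub_const _).aestronglyMeasurable
    (ε := (c / 2 : ℝ≥0) * volume E) (mul_ne_zero hκ0 hpos.ne')
    (fun h => absurd h (ENNReal.mul_ne_top ENNReal.coe_ne_top hvt))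
  rw [hr'] at key
  calc μX {x | siegelTransform G P (E.indicator 1) x ≤ (c / 2 : ℝ≥0) * volume E}
      ≤ _ := measure_mono fun x hx => ?_
    _ ≤ _ := key
    _ ≤ (((c / 2 : ℝ≥0) : ℝ≥0∞) * volume E)⁻¹ ^ r * (D * volume E ^ (1 / r)) ^ r := by gcongr
    _ = _ := ?_
  · obtain ⟨V, hV⟩ : ∃ V : ℝ≥0, (V : ℝ≥0∞) = volume E := ⟨_, ENNReal.coe_toNNReal hvt⟩
    have hx' : siegelTransform G P (E.indicator 1) x ≤ (c / 2 : ℝ≥0) * volume E := hx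
    rw [← hV, ← ENNReal.coe_mul] at hx'
    obtain ⟨s, hs⟩ : ∃ s : ℝ≥0, (s : ℝ≥0∞) = siegelTransform G P (E.indicator 1) x :=
      ⟨_, ENNReal.coe_toNNReal (ne_top_of_le_ne_top ENNReal.coe_ne_top hx')⟩
    rw [← hs] at hx'
    have hx'' : (s : ℝ) ≤ c / 2 * V := by exact_mod_cast hx'
    simp only [mem_ofPred_eq]
    rw [← hs, ← hV, ← ENNReal.coe_mul, ← ENNReal.coe_mul, ← ofReal_norm,
      ← ENNReal.ofReal_coe_nnreal]
    refine ENNReal.ofReal_le_ofReal ?_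
    simp only [ENNReal.coe_toReal, NNReal.coe_mul, NNReal.coe_div, NNReal.coe_ofNat]
    rw [Real.norm_eq_abs, abs_sub_comm]
    refine le_trans ?_ (le_abs_self _)
    linarith
  · have h1 : ((volume E)⁻¹ ^ r) * volume E = volume E ^ (1 - r) := by
      rw [sub_eq_neg_add, ENNReal.rpow_add _ _ hpos.ne' hvt, ENNReal.rpow_one, ENNReal.inv_rpow,
        ENNReal.rpow_neg]
    rw [ENNReal.mul_inv (Or.inl hκ0) (Or.inl ENNReal.coe_ne_top),
      ENNReal.mul_rpow_of_nonneg _ _ hr0.le, ENNReal.mul_rpow_of_nonneg _ _ hr0.le,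
      ← ENNReal.rpow_mul, one_div_mul_cancel hr0.ne', ENNReal.rpow_one, ← h1]
    ring

/-- If `A` has infinite volume, almost every `gP` has infinitely many points in `A`. -/
theorem IsRogersType.ae_siegelTransform_eq_top (hS : IsSiegelType G P μX) {r : ℝ}
    (hr : 1 < r) (hR : IsRogersType G P r μX) (hP : P.Countable)
    {A : Set (Fin n → ℝ)} (hA : MeasurableSet A) (hvol : volume A = ∞) :
    ∀ᵐ x ∂μX, siegelTransform G P (A.indicator 1) x = ∞ := by
  obtain ⟨κ, K, hκ, hK, h⟩ := hR.exists_measure_siegelTransform_le hS hr hP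
  let E : ℕ → Set (Fin n → ℝ) := fun N => A ∩ Metric.closedBall 0 N
  have hEm : ∀ N, MeasurableSet (E N) := fun N => hA.inter measurableSet_closedBall
  have hEb : ∀ N, Bornology.IsBounded (E N) := fun N =>
    Metric.isBounded_closedBall.subset inter_subset_right
  have hEU : ⋃ N, E N = A := by
    rw [← inter_iUnion, Metric.iUnion_closedBall_nat, inter_univ]
  have hlim : Tendsto (fun N => volume (E N)) atTop (𝓝 ∞) := by
    rw [← hvol, ← hEU]
    exact tendsto_measure_iUnion_atTop fun i j hij =>
      inter_subset_inter_right _ (Metric.closedBall_subset_closedBall (by exact_mod_cast hij))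
  have hB : ∀ B : ℕ, ∀ᵐ x ∂μX, (B : ℝ≥0∞) < siegelTransform G P (A.indicator 1) x := by
    intro B
    simp only [ae_iff, not_lt]
    -- Here `r > 1` is essential: the failure probabilities vanish as the truncated volumes grow,
    -- while the guaranteed count `κ m(E_N)` passes any `B`.
    have hlim2 : Tendsto (fun N => K * volume (E N) ^ (1 - r)) atTop (𝓝 0) := by
      have h1 := ENNReal.Tendsto.const_mul
        ((ENNReal.continuous_rpow_const (y := 1 - r)).continuousAt.tendsto.comp hlim)
        (Or.inr hK)
      rwa [ENNReal.top_rpow_of_neg (by linarith), mul_zero] at h1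
    have hlim3 : Tendsto (fun N => κ * volume (E N)) atTop (𝓝 ∞) := by
      have h1 := ENNReal.Tendsto.const_mul hlim (a := κ) (Or.inl ENNReal.top_ne_zero)
      rwa [ENNReal.mul_top hκ] at h1
    refine le_antisymm (ge_of_tendsto hlim2 ?_) zero_le
    filter_upwards [hlim.eventually_const_lt (u := 0) ENNReal.zero_lt_top,
      hlim3.eventually_const_lt (u := (B : ℝ≥0∞)) (by simp)] with N hN0 hNB
    refine (measure_mono fun x hx => ?_).trans (h (E N) (hEm N) (hEb N) hN0)
    refine le_trans ?_ ((show _ ≤ (B : ℝ≥0∞) from hx).trans hNB.le)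
    induction x using QuotientGroup.induction_on with
    | H g =>
      rw [siegelTransform_indicator_mk, siegelTransform_indicator_mk]
      have hsub : {v ∈ P | g • v ∈ E N} ⊆ {v ∈ P | g • v ∈ A} := fun v hv => ⟨hv.1, hv.2.1⟩
      exact_mod_cast encard_le_encard hsub
  filter_upwards [ae_all_iff.2 hB] with x hx
  exact ENNReal.eq_top_of_forall_nnreal_le fun q => by
    obtain ⟨B, hB⟩ := exists_nat_ge q
    exact le_trans (by exact_mod_cast hB) (hx B).le

/-- Borel–Cantelli: an empty intersection with `E k` is a particular case of the Chebyshev event,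
and these events have summable probabilities. -/
theorem IsRogersType.ae_eventually_siegelTransform_ne_zero (hS : IsSiegelType G P μX) {r : ℝ}
    (hr : 1 < r) (hR : IsRogersType G P r μX) (hP : P.Countable)
    {E : ℕ → Set (Fin n → ℝ)} (hEm : ∀ k, MeasurableSet (E k))
    (hEb : ∀ k, Bornology.IsBounded (E k)) (hE0 : ∀ k, 0 < volume (E k))
    (hsum : ∑' k, volume (E k) ^ (1 - r) ≠ ∞) :
    ∀ᵐ x ∂μX, ∀ᶠ k in atTop, siegelTransform G P ((E k).indicator 1) x ≠ 0 := by
  obtain ⟨κ, K, hκ, hK, h⟩ := hR.exists_measure_siegelTransform_le hS hr hP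
  have hfin : ∑' k, μX {x | siegelTransform G P ((E k).indicator 1) x ≤ κ * volume (E k)} ≠ ∞ := by
    refine ne_top_of_le_ne_top ?_ (ENNReal.tsum_le_tsum fun k => h _ (hEm k) (hEb k) (hE0 k))
    rw [ENNReal.tsum_mul_left]
    exact ENNReal.mul_ne_top hK hsum
  filter_upwards [ae_eventually_notMem hfin] with x hx
  filter_upwards [hx] with k hk h0
  exact hk (by simp [h0])

end Siegel

/-! ### Passing between `ν(x)` and `ν(gx)`; volumes of the boxes -/

section Approximation

variable {n ℓ : ℕ} {ν : Seminorm ℝ (Fin n → ℝ)} {ψ : ℝ≥0 → (Fin ℓ → ℝ)}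
  {F : (Fin n → ℝ) → (Fin ℓ → ℝ)}

/-- Outside a bounded set `ν (g • x) ≤ C ν x`, and regularity at dilation `C` gives `ψ(ν x) ≤ β⁻¹
ψ(ν (g • x))`. Taking `M` natural keeps the family of enlarged sets countable. -/
theorem ASL.exists_approxSet_comp_subset (hν : ∀ x, ν x = 0 → x = 0)
    (hψpos : ∀ t j, 0 < ψ t j) (hψreg : IsRegularFun ψ) (hψanti : Antitone ψ) (g : ASL n) :
    ∃ (C : ℝ) (M : ℕ), approxSet (fun x => F (g • x)) ψ ν ⊆
      {x | ν x ≤ C} ∪ {x | g • x ∈ approxSet F ((M + 1 : ℝ) • ψ) ν} := by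
  obtain ⟨C, hC, hg⟩ := g.exists_seminorm_smul_comparable hν
  obtain ⟨β, hβ, h⟩ := hψreg.exists_smul_le hψanti C.toNNReal
  obtain ⟨M, hM⟩ := exists_nat_ge β⁻¹
  refine ⟨C, M, fun x hx => or_iff_not_imp_left.2 fun hCx j => ?_⟩
  have hCx' : C < ν x := not_le.1 hCx
  have hνx : 0 < ν x := by linarith
  have h1 : β * ψ (ν x).toNNReal j ≤ ψ (ν (g • x)).toNNReal j :=
    (h _ (Real.toNNReal_pos.2 hνx) j).trans (hψanti (by
      rw [← Real.toNNReal_mul (by linarith)]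
      exact Real.toNNReal_le_toNNReal (hg x hCx'.le).1) j)
  calc |F (g • x) j| ≤ ψ (ν x).toNNReal j := hx j
    _ ≤ β⁻¹ * ψ (ν (g • x)).toNNReal j := (le_inv_mul_iff₀ hβ).2 h1
    _ ≤ (M + 1) * ψ (ν (g • x)).toNNReal j :=
      mul_le_mul_of_nonneg_right (by linarith) (hψpos _ j).le

theorem ASL.exists_subset_approxSet_comp (hν : ∀ x, ν x = 0 → x = 0)
    (hψpos : ∀ t j, 0 < ψ t j) (hψreg : IsRegularFun ψ) (hψanti : Antitone ψ) (g : ASL n) :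
    ∃ (C : ℝ) (M : ℕ), {x | g • x ∈ approxSet F ((M + 1 : ℝ)⁻¹ • ψ) ν} ⊆
      {x | ν x ≤ C} ∪ approxSet (fun x => F (g • x)) ψ ν := by
  obtain ⟨C, hC, hg⟩ := g.exists_seminorm_smul_comparable hν
  obtain ⟨β, hβ, h⟩ := hψreg.exists_smul_le hψanti C.toNNReal
  obtain ⟨M, hM⟩ := exists_nat_ge β⁻¹
  refine ⟨C, M, fun x hx => or_iff_not_imp_left.2 fun hCx j => ?_⟩
  have hCx' : C < ν x := not_le.1 hCx
  have hνx : 0 < ν (g • x) := by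
    have := (hg x hCx'.le).2
    by_contra! hle
    nlinarith
  calc |F (g • x) j| ≤ (M + 1 : ℝ)⁻¹ * ψ (ν (g • x)).toNNReal j := hx j
    _ ≤ β * ψ (ν (g • x)).toNNReal j :=
      mul_le_mul_of_nonneg_right (inv_le_of_inv_le₀ hβ (by linarith)) (hψpos _ j).le
    _ ≤ ψ (ν x).toNNReal j :=
      (h _ (Real.toNNReal_pos.2 hνx) j).trans (hψanti (by
        rw [← Real.toNNReal_mul (by linarith)]
        exact Real.toNNReal_le_toNNReal (hg x hCx'.le).2) j)

theorem measurableSet_boxSet (hF : Measurable F) (ε : Fin ℓ → ℝ) (ν : Seminorm ℝ (Fin n → ℝ))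
    (T : ℝ) : MeasurableSet (boxSet F ε ν T) := by
  have : boxSet F ε ν T = (⋂ j, {x | |F x j| ≤ ε j}) ∩ {x | ν x ≤ T} := by
    ext x
    simp [boxSet]
  rw [this]
  exact (MeasurableSet.iInter fun j => measurableSet_le ((measurable_pi_apply j).comp hF).abs
    measurable_const).inter (measurableSet_le ν.continuous_pi.measurable measurable_const)

/-- One shell inside the box already has enough volume. Evaluating `ψ` a further `m` scales out, as
the distortion by `g` will require, costs only a factor independent of `i`. -/
theorem IsHomogeneousOfDegree.exists_le_volume_boxSet {f : (Fin n → ℝ) → (Fin ℓ → ℝ)}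
    {δ : Fin ℓ → ℝ} (hf : IsHomogeneousOfDegree f δ)
    (hν : ∀ x, ν x = 0 → x = 0) (hfC1 : ContDiffOn ℝ 1 f {0}ᶜ) (hZ : (zeroSet f).Nonempty)
    (hreg : ∀ x ∈ zeroSet f, Function.Surjective (fderiv ℝ f x)) (ξ : Fin ℓ → ℝ) {d : ℝ}
    (hd : d = ∑ j, δ j) (hψpos : ∀ t j, 0 < ψ t j) (hψanti : Antitone ψ) :
    ∃ c : ℝ≥0∞, c ≠ 0 ∧ ∃ k₁ : ℕ, ∀ m i : ℕ,
      c * (ENNReal.ofReal (((2 : ℝ) ^ m) ^ (-((n : ℝ) - d))) *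
        dyadicTerm ψ ((n : ℝ) - d) (i + k₁ + m)) ≤
      volume (boxSet (shifted ξ f) (ψ (2 ^ (i + k₁ + m))) ν (2 ^ (i + k₁ + 1))) := by
  obtain ⟨c, C, hc, -, hbounds⟩ := hf.exists_volume_shell_bounds hν hfC1 hZ hreg ξ hd
  obtain ⟨k₁, hk₁⟩ := eventually_atTop.1
    ((tendsto_pow_atTop_atTop_of_one_lt (one_lt_two (α := ℝ))).eventually (hbounds ‖ψ 0‖))
  refine ⟨c, hc, k₁, fun m i => ?_⟩
  rw [← ofReal_two_pow_rpow_mul_prod_add]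
  refine (hk₁ (i + k₁) (Nat.le_add_left _ _) _ (fun j => (hψpos _ j).le)
    (antitone_apply_le hψanti _)).1.trans (measure_mono fun x hx => ⟨?_, ?_⟩)
  · exact mem_Icc_iff_abs_shifted_le.1 hx.2
  · rw [pow_succ']
    exact hx.1.2

theorem ENNReal.rpow_le_rpow_of_nonpos' {x y : ℝ≥0∞} {z : ℝ} (hz : z ≤ 0) (h : x ≤ y) :
    y ^ z ≤ x ^ z := by
  rw [← neg_neg z, ENNReal.rpow_neg y, ENNReal.rpow_neg x, ENNReal.inv_le_inv]
  exact ENNReal.rpow_le_rpow h (by linarith)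

theorem dyadicTerm_succ_rpow (hψpos : ∀ t j, 0 < ψ t j) (e s : ℝ) (k : ℕ) :
    dyadicTerm ψ e (k + 1) ^ s =
      ENNReal.ofReal (((2 : ℝ) ^ (((k : ℝ) + 1) * e) * ∏ j, ψ ((2 : ℝ≥0) ^ (k + 1)) j) ^ s) := by
  have hprod : 0 < ∏ j, ψ ((2 : ℝ≥0) ^ (k + 1)) j := Finset.prod_pos fun j _ => hψpos _ j
  rw [← ENNReal.ofReal_rpow_of_pos (by positivity), ENNReal.ofReal_mul (by positivity),
    ENNReal.ofReal_prod_of_nonneg fun j _ => (hψpos _ j).le, dyadicTerm, Real.rpow_mul zero_le_two]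
  norm_cast

theorem dyadicTerm_ne_zero (hψpos : ∀ t j, 0 < ψ t j) (e : ℝ) (k : ℕ) :
    dyadicTerm ψ e k ≠ 0 := by
  refine mul_ne_zero ?_ (Finset.prod_ne_zero_iff.2 fun j _ => ?_)
  · simpa using Real.rpow_pos_of_pos (by positivity) e
  · simpa using hψpos _ j

end Approximation

/-! ### From point counts to approximability -/

section Main

variable {n ℓ : ℕ} {G : Subgroup (ASL n)} {P : Set (Fin n → ℝ)}
  {ν : Seminorm ℝ (Fin n → ℝ)} {ψ : ℝ≥0 → (Fin ℓ → ℝ)} {F : (Fin n → ℝ) → (Fin ℓ → ℝ)}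

theorem not_isApproximable_of_siegelTransform_ne_top (hP : P ⊆ integerPoints n)
    (hν : ∀ x, ν x = 0 → x = 0) (hψpos : ∀ t j, 0 < ψ t j) (hψreg : IsRegularFun ψ)
    (hψanti : Antitone ψ) {g : G}
    (hg : ∀ M : ℕ, siegelTransform G P ((approxSet F ((M + 1 : ℝ) • ψ) ν).indicator 1)
      (g : CosetSpace G P) ≠ ∞) :
    ¬ IsApproximable (fun x => F (g • x)) ψ ν P := by
  obtain ⟨C, M, hsub⟩ := (g : ASL n).exists_approxSet_comp_subset (F := F) hν hψpos hψreg hψanti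
  have hM := hg M
  rw [siegelTransform_indicator_mk] at hM
  have hfin : {v ∈ P | g • v ∈ approxSet F ((M + 1 : ℝ) • ψ) ν}.Finite := by
    simpa using hM
  refine not_infinite.2 (((finite_integerPoints_inter hν C).union hfin).subset fun x hx => ?_)
  rcases hsub hx.1 with h | h
  · exact Or.inl ⟨hP hx.2, h⟩
  · exact Or.inr ⟨hx.2, h⟩

theorem isApproximable_of_siegelTransform_eq_top (hP : P ⊆ integerPoints n)
    (hν : ∀ x, ν x = 0 → x = 0) (hψpos : ∀ t j, 0 < ψ t j) (hψreg : IsRegularFun ψ)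
    (hψanti : Antitone ψ) {g : G}
    (hg : ∀ M : ℕ, siegelTransform G P ((approxSet F ((M + 1 : ℝ)⁻¹ • ψ) ν).indicator 1)
      (g : CosetSpace G P) = ∞) :
    IsApproximable (fun x => F (g • x)) ψ ν P := by
  obtain ⟨C, M, hsub⟩ := (g : ASL n).exists_subset_approxSet_comp (F := F) hν hψpos hψreg hψanti
  have hM := hg M
  rw [siegelTransform_indicator_mk] at hM
  have hinf : {v ∈ P | g • v ∈ approxSet F ((M + 1 : ℝ)⁻¹ • ψ) ν}.Infinite := by
    simpa using hM
  refine fun hfin => hinf (((finite_integerPoints_inter hν C).union hfin).subset fun x hx => ?_)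
  rcases hsub hx.2 with h | h
  · exact Or.inl ⟨hP hx.1, h⟩
  · exact Or.inr ⟨h, hx.1⟩

theorem isUniformlyApproximable_of_siegelTransform_ne_zero (hν : ∀ x, ν x = 0 → x = 0)
    (hψanti : Antitone ψ) {g : G} (k₁ : ℕ)
    (hg : ∀ m : ℕ, ∀ᶠ i : ℕ in atTop, siegelTransform G P
      ((boxSet F (ψ (2 ^ (i + k₁ + (m + 2)))) ν (2 ^ (i + k₁ + 1))).indicator 1)
      (g : CosetSpace G P) ≠ 0) :
    IsUniformlyApproximable (fun x => F (g • x)) ψ ν P := by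
  obtain ⟨C, hC, hCg⟩ := ((g : ASL n)⁻¹).exists_seminorm_smul_le hν
  -- Undoing `g` multiplies a radius of at least `1` by at most `2C < 2^m`. For `T` between
  -- `2^(K+m+1)` and `2^(K+m+2)`, a point with `ν (g • v) ≤ 2^(K+1)` then has `ν v ≤ T`, and
  -- `ψ(2^(K+m+2)) ≤ ψ(T)`.
  obtain ⟨m, hm⟩ := pow_unbounded_of_one_lt (2 * C) one_lt_two
  obtain ⟨i₀, hi₀⟩ := eventually_atTop.1 (hg m)
  filter_upwards [eventually_gt_atTop ((2 : ℝ) ^ (i₀ + (k₁ + m + 1)))] with T hT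
  have hT' : T ∈ Ioi ((2 : ℝ) ^ (i₀ + (k₁ + m + 1))) := hT
  rw [← iUnion_Ioc_two_pow] at hT'
  obtain ⟨i, hi⟩ := mem_iUnion.1 hT'
  have h := hi₀ (i + i₀) (Nat.le_add_left _ _)
  rw [siegelTransform_indicator_mk] at h
  have hne : {v ∈ P | g • v ∈ boxSet F (ψ (2 ^ (i + i₀ + k₁ + (m + 2)))) ν
      (2 ^ (i + i₀ + k₁ + 1))}.Nonempty := by
    rw [nonempty_iff_ne_empty]
    rintro h0
    simp [h0] at h
  obtain ⟨v, hvP, hv, hvν⟩ := hne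
  refine ⟨v, ⟨fun j => (hv j).trans (hψanti (toNNReal_le_two_pow ?_) j), ?_⟩, hvP⟩
  · exact hi.2.trans_eq (by congr 1; ring)
  · have h1 := hCg (g • v)
    rw [Subgroup.smul_def, inv_smul_smul] at h1
    have h2 : (1 : ℝ) ≤ 2 ^ (i + i₀ + k₁ + 1) := one_le_pow₀ one_le_two
    calc ν v ≤ C * (2 ^ (i + i₀ + k₁ + 1) + 2 ^ (i + i₀ + k₁ + 1)) :=
          h1.trans (mul_le_mul_of_nonneg_left (add_le_add hvν h2) (by linarith))
      _ = 2 * C * 2 ^ (i + i₀ + k₁ + 1) := by ring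
      _ ≤ 2 ^ m * 2 ^ (i + i₀ + k₁ + 1) := by gcongr
      _ = 2 ^ (i + (i₀ + (k₁ + m + 1))) := by ring
      _ ≤ T := hi.1.le

end Main

theorem mainTheorem1 {n ℓ : ℕ} (hn : 2 ≤ n) (hℓ : 1 ≤ ℓ)
    (G : Subgroup (ASL n)) (hG : IsClosed (G : Set (ASL n)))
    (P : Set (Fin n → ℝ)) (hP : P ⊆ integerPoints n)
    (hΓ : IsLatticeIn (stabGroup G P))
    (μX : Measure (CosetSpace G P)) [IsProbabilityMeasure μX]
    [SMulInvariantMeasure G (CosetSpace G P) μX]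
    (hSiegel : IsSiegelType G P μX)
    (r : ℝ) (hr : 1 < r) (hRogers : IsRogersType G P r μX)
    (μG : Measure G) [μG.IsHaarMeasure]
    (ν : Seminorm ℝ (Fin n → ℝ)) (hν : ∀ x, ν x = 0 → x = 0)
    (ψ : ℝ≥0 → (Fin ℓ → ℝ)) (hψpos : ∀ t j, 0 < ψ t j)
    (hψreg : IsRegularFun ψ) (hψanti : Antitone ψ)
    (f : (Fin n → ℝ) → (Fin ℓ → ℝ)) (δ : Fin ℓ → ℝ) (hf : IsHomogeneousOfDegree f δ)
    (hfC1 : ContDiffOn ℝ 1 f {0}ᶜ)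
    (hZ : (zeroSet f).Nonempty)
    (hreg : ∀ x ∈ zeroSet f, Function.Surjective (fderiv ℝ f x))
    (ξ : Fin ℓ → ℝ) (d : ℝ) (hd : d = ∑ j, δ j) :
    ((∫⁻ t in Set.Ioi (1 : ℝ),
          ENNReal.ofReal (t ^ ((n : ℝ) - (d + 1)) * ∏ j, ψ t.toNNReal j) < ∞ →
        ∀ᵐ g ∂μG, ¬ IsApproximable (fun x => shifted ξ f (g • x)) ψ ν P) ∧
      (∫⁻ t in Set.Ioi (1 : ℝ),
          ENNReal.ofReal (t ^ ((n : ℝ) - (d + 1)) * ∏ j, ψ t.toNNReal j) = ∞ →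
        ∀ᵐ g ∂μG, IsApproximable (fun x => shifted ξ f (g • x)) ψ ν P)) ∧
    (d < n →
      Summable (fun k : ℕ =>
        ((2 : ℝ) ^ (((k : ℝ) + 1) * ((n : ℝ) - d)) *
          ∏ j, ψ ((2 : ℝ≥0) ^ (k + 1)) j) ^ (1 - r)) →
        ∀ᵐ g ∂μG, IsUniformlyApproximable (fun x => shifted ξ f (g • x)) ψ ν P) := by
  have hPc := countable_of_subset_integerPoints hP
  have : DiscreteTopology (stabGroup G P) := hΓ.1
  have : SigmaCompactSpace G := hG.isClosedEmbedding_subtypeVal.sigmaCompactSpace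
  have : SecondCountableTopology G :=
    inferInstanceAs (SecondCountableTopology (G : Set (ASL n)))
  have hF : Measurable (shifted ξ f) := hf.1.const_add (-ξ)
  -- The closedness of `G` enters here: it makes `G` σ-compact, hence the Haar measure `μG`
  -- s-finite.
  have hlift {p : CosetSpace G P → Prop} (h : ∀ᵐ x ∂μX, p x) :
      ∀ᵐ g : G ∂μG, p (g : CosetSpace G P) := ae_of_ae_quotient (stabGroup G P) μX μG h
  have hint := lintegral_ne_top_iff_tsum_dyadicTerm hψpos hψanti ((n : ℝ) - d)
  have hvol : ∀ M : ℝ, 0 < M → _ := fun M hM =>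
    hf.volume_approxSet_ne_top_iff hν hfC1 hZ hreg ξ hd hψreg.1 hψpos hψanti hM
  have hApp : ∀ M : ℝ, MeasurableSet (approxSet (shifted ξ f) (M • ψ) ν) := fun M =>
    measurableSet_approxSet hF (hψreg.1.const_smul M) ν
  simp only [← sub_sub]
  refine ⟨⟨fun h => ?_, fun h => ?_⟩, fun _ h => ?_⟩
  · have hae : ∀ᵐ x ∂μX, ∀ M : ℕ, siegelTransform G P
        ((approxSet (shifted ξ f) ((M + 1 : ℝ) • ψ) ν).indicator 1) x ≠ ∞ :=
      ae_all_iff.2 fun M => hSiegel.ae_siegelTransform_ne_top hPc (hApp _)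
        ((hvol _ (by positivity)).2 (hint.1 h.ne))
    filter_upwards [hlift hae] with g hg
    exact not_isApproximable_of_siegelTransform_ne_top hP hν hψpos hψreg hψanti hg
  · have hae : ∀ᵐ x ∂μX, ∀ M : ℕ, siegelTransform G P
        ((approxSet (shifted ξ f) ((M + 1 : ℝ)⁻¹ • ψ) ν).indicator 1) x = ∞ :=
      ae_all_iff.2 fun M => hRogers.ae_siegelTransform_eq_top hSiegel hr hPc (hApp _)
        (by_contra fun hne => hint.2 ((hvol _ (by positivity)).1 hne) h)
    filter_upwards [hlift hae] with g hg
    exact isApproximable_of_siegelTransform_eq_top hP hν hψpos hψreg hψanti hg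
  · obtain ⟨c, hc, k₁, hbox⟩ :=
      hf.exists_le_volume_boxSet hν hfC1 hZ hreg ξ hd hψpos hψanti
    have hsum : ∑' k, dyadicTerm ψ ((n : ℝ) - d) (k + 1) ^ (1 - r) ≠ ∞ := by
      simp_rw [dyadicTerm_succ_rpow hψpos]
      exact h.tsum_ofReal_ne_top
    have hae : ∀ᵐ x ∂μX, ∀ m : ℕ, ∀ᶠ i : ℕ in atTop, siegelTransform G P ((boxSet (shifted ξ f)
        (ψ (2 ^ (i + k₁ + (m + 2)))) ν (2 ^ (i + k₁ + 1))).indicator 1) x ≠ 0 := by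
      refine ae_all_iff.2 fun m => ?_
      -- For fixed `m` this factor does not depend on `i`, so the sum of the failure bounds is at
      -- most a constant times a tail of the given series.
      set κ := c * ENNReal.ofReal (((2 : ℝ) ^ (m + 2)) ^ (-((n : ℝ) - d))) with hκ
      have hκ0 : κ ≠ 0 := mul_ne_zero hc (by simpa using Real.rpow_pos_of_pos (by positivity) _)
      have hle := hbox (m + 2)
      simp_rw [← mul_assoc, ← hκ] at hle
      refine hRogers.ae_eventually_siegelTransform_ne_zero hSiegel hr hPc
        (fun i => measurableSet_boxSet hF _ ν _)
        (fun i => (ν.isBounded_setOf_le hν _).subset fun x hx => hx.2)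
        (fun i => (pos_iff_ne_zero.2 (mul_ne_zero hκ0 (dyadicTerm_ne_zero hψpos _ _))).trans_le
          (hle i)) ?_
      refine ne_top_of_le_ne_top ?_ (ENNReal.tsum_le_tsum fun i =>
        ENNReal.rpow_le_rpow_of_nonpos' (by linarith) (hle i))
      simp_rw [ENNReal.mul_rpow_of_ne_zero hκ0 (dyadicTerm_ne_zero hψpos _ _)]
      rw [ENNReal.tsum_mul_left]
      refine ENNReal.mul_ne_top ?_ (ne_top_of_le_ne_top hsum
        (ENNReal.tsum_comp_le_tsum_of_injective (f := fun i : ℕ => i + k₁ + (m + 1))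
          (fun i j hij => by simpa using hij)
          (fun k => dyadicTerm ψ ((n : ℝ) - d) (k + 1) ^ (1 - r))))
      rw [Ne, ENNReal.rpow_eq_top_iff]
      simp [hκ0, hr.le, not_lt.2]
    filter_upwards [hlift hae] with g hg
    exact isUniformlyApproximable_of_siegelTransform_ne_zero hν hψanti k₁ hg
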